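/- Let $g\ge 0$ and let $-1<\alpha_1<\beta_1<\alpha_2<\beta_2<\dots<\alpha_g<\beta_g<1$. Put $$E=[-1,\alpha_1]\cup[\beta_1,\alpha_2]\cup\dots\cup[\beta_{g-1},\alpha_g]\cup[\beta_g,1]$$ (so $E=[-1,1]$ if $g=0$), a union of $g+1$ disjoint subintervals, and on $E$ consider the weight $$w(x)=\frac1\pi\sqrt{\frac{\prod_{j=1}^g(x-\alpha_j)}{(1-x^2)\prod_{j=1}^g(x-\beta_j)}}.$$ Let $P_n$ ($n\ge 0$) be the monic polynomials, $\deg P_n=n$, with $\int_E P_nP_m\,w\,dx=h_n\delta_{nm}$ (the generalized Chebyshev polynomials on $E$), and let $a_n,b_n$ ($n\ge1$) be the coefficients of their recurrence relation $$xP_n(x)=P_{n+1}(x)+b_{n+1}P_n(x)+a_nP_{n-1}(x)\qquad(n\ge 0,\ P_{-1}=0).$$ Suppose that the recurrence coefficients have period $\mathfrak K\ge 1$, that is, $b_{n+\mathfrak K}=b_n$ for all $n\ge 1$ and $a_{n+\mathfrak K}=a_n$ for all $n\ge 2$ ($\mathfrak K$ need not be the smallest period). Put $\Delta_{\mathfrak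 K}=\sqrt{2h_{\mathfrak K}}>0$ and $M_{\mathfrak K}(x)=P_{\mathfrak K}(x)/\Delta_{\mathfrak K}$. Then: 1. $M_{\mathfrak K}$ maps each of the $g+1$ subintervals of $E$ onto $[-1,1]$. 2. $E$ is the full preimage of $[-1,1]$: $\{x\in\mathbb R: M_{\mathfrak K}(x)\in[-1,1]\}=E$, and also $\{z\in\mathbb C: M_{\mathfrak K}(z)\in[-1,1]\}=E$. 3. For every $n\ge 0$, $T_n(M_{\mathfrak K}(x))=\Delta_{\mathfrak K}^{-n}P_{n\mathfrak K}(x)$, where $T_n$ is the monic Chebyshev polynomial of the first kind of degree $n$; in particular $T_n(M_{\mathfrak K})$ is proportional to $P_{n\mathfrak K}$. 4. $E$ has at most $\mathfrak K$ subintervals: $g\le\mathfrak K-1$. -/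

import Mathlib

open Polynomial

noncomputable section

namespace GenChebyshev

/-- Left endpoints `-1, β₁, …, β_g` of the `g + 1` subintervals of `E`. -/
def bandLeft {g : ℕ} (β : Fin g → ℝ) : Fin (g + 1) → ℝ :=
  Fin.cons (-1) β

/-- Right endpoints `α₁, …, α_g, 1` of the `g + 1` subintervals of `E`. -/
def bandRight {g : ℕ} (α : Fin g → ℝ) : Fin (g + 1) → ℝ :=
  Fin.snoc α 1

/-- `-1 < α₁ < β₁ < α₂ < β₂ < ⋯ < α_g < β_g < 1`: all subintervals and all gaps are
nondegenerate. -/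
structure IsBranchPoints {g : ℕ} (α β : Fin g → ℝ) : Prop where
  band : ∀ k, bandLeft β k < bandRight α k
  gap : ∀ j, α j < β j

/-- The `k`-th subinterval of `E`. -/
def band {g : ℕ} (α β : Fin g → ℝ) (k : Fin (g + 1)) : Set ℝ :=
  Set.Icc (bandLeft β k) (bandRight α k)

/-- `E = [-1, α₁] ∪ [β₁, α₂] ∪ ⋯ ∪ [β_g, 1]`. -/
def E {g : ℕ} (α β : Fin g → ℝ) : Set ℝ :=
  ⋃ k, band α β k

/-- The weight on `E`. Its values at the finitely many endpoints, where the denominator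
may vanish, do not affect integrals. -/
def weight {g : ℕ} (α β : Fin g → ℝ) (x : ℝ) : ℝ :=
  1 / Real.pi * √((∏ j, (x - α j)) / ((1 - x ^ 2) * ∏ j, (x - β j)))

/-- The pairing `∫_E p q w dx`. -/
def pairing {g : ℕ} (α β : Fin g → ℝ) (p q : ℝ[X]) : ℝ :=
  ∫ x in E α β, p.eval x * q.eval x * weight α β x

/-- `P` is the sequence of monic polynomials, `P n` of degree `n`, orthogonal on `E` with
respect to the weight. -/
structure IsMonicOrthogonal {g : ℕ} (α β : Fin g → ℝ) (P : ℕ → ℝ[X]) : Prop where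
  monic : ∀ n, (P n).Monic
  natDegree_eq : ∀ n, (P n).natDegree = n
  orthogonal : ∀ m n, m ≠ n → pairing α β (P m) (P n) = 0

/-- `a₁, a₂, …` and `b₁, b₂, …` are the coefficients of the three-term recurrence
`x Pₙ = Pₙ₊₁ + bₙ₊₁ Pₙ + aₙ Pₙ₋₁` (`n ≥ 0`, `P₋₁ = 0`). The values `a 0`, `b 0` play no role. -/
structure IsRecurrence (P : ℕ → ℝ[X]) (a b : ℕ → ℝ) : Prop where
  zero : X * P 0 = P 1 + C (b 1) * P 0
  succ : ∀ n, X * P (n + 1) = P (n + 2) + C (b (n + 2)) * P (n + 1) + C (a (n + 1)) * P n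

/-- The recurrence coefficients have period `K`. The coefficient `a₁` is exceptional (it carries
an extra factor `2` already for the classical Chebyshev polynomials) and is left out. -/
structure HasPeriod (a b : ℕ → ℝ) (K : ℕ) : Prop where
  pos : 0 < K
  a_periodic : ∀ n, 2 ≤ n → a (n + K) = a n
  b_periodic : ∀ n, 1 ≤ n → b (n + K) = b n

/-- `Δₙ = √(2 hₙ)` with `hₙ = ∫_E Pₙ² w dx`. -/
def Delta {g : ℕ} (α β : Fin g → ℝ) (P : ℕ → ℝ[X]) (n : ℕ) : ℝ :=
  √(2 * pairing α β (P n) (P n))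

/-- The normalized polynomial `Pₙ / Δₙ`. -/
def normalized {g : ℕ} (α β : Fin g → ℝ) (P : ℕ → ℝ[X]) (n : ℕ) : ℝ[X] :=
  C (Delta α β P n)⁻¹ * P n

/-- The monic Chebyshev polynomial of the first kind of degree `n`. -/
def monicT (n : ℕ) : ℝ[X] :=
  C (Chebyshev.T ℝ n).leadingCoeff⁻¹ * Chebyshev.T ℝ n

end GenChebyshev

end

/-!
Write `A = ∏ (x - α j)` and `B = (x ^ 2 - 1) ∏ (x - β j)`, so that `A B ≤ 0` exactly on `E`. The
rational function `-∏ (x - r i) / ∏ (x - l i)` attached to the intervals `[l i, r i]` of `E`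
decreases from `∞` to `0` on each of them. Taking its value `u` as the variable on all the
intervals at once, partial fractions collapse the Stieltjes transform of the weight to
`∫ u ^ (-1/2) / (s + t u) du = π / √(s t)`, and it comes out as `√(A / B)`.

The functions of the second kind `P n √(A / B) - Q n`, with `Q n` the polynomials of the second
kind, solve the recurrence and decay at infinity to order greater than `n`. If the coefficients
have period `K`, the Casoratian of this solution and of its shift by `K` depends on `n` only
through a constant factor, so it decays faster than any power. It is a polynomial combination of
`1` and `√(A / B)`, hence zero. This gives `Q K = A S` for a polynomial `S`, together with the
Pell equation `P K ^ 2 - A B S ^ 2 = Δ ^ 2` and the relations for the shift by `K` behind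
`T n (P K / Δ) = Δ ^ (-n) P (n K)`. In particular `A` divides `Q K`, which has degree `K - 1`.

Finally `P K / (A S)` and `B S / P K` are Herglotz functions, because they are continued fractions
of the recurrence. With the Pell equation this forces `A B ≤ 0` at the real zeros of `S`, keeps
the critical values of `P K / Δ` out of `(-1, 1)`, and keeps the preimage of `[-1, 1]` on the real
line.
-/

noncomputable section

namespace GenChebyshev

open Asymptotics Filter Function MeasureTheory Topology
open Finset (univ)
open Lagrange (nodal)

section PartialFractions

variable {ι K : Type*} [Field K] {s : Finset ι} {v : ι → K}

lemma eval_div_eval_nodal (hv : Set.InjOn v s) {p : K[X]} (hp : p.degree < s.card) {z : K}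
    (hz : ∀ i ∈ s, z ≠ v i) :
    p.eval z / (nodal s v).eval z =
      ∑ i ∈ s, p.eval (v i) / (nodal s v).derivative.eval (v i) / (z - v i) := by
  classical
  rw [Lagrange.eq_interpolate hv hp, Lagrange.eval_interpolate_not_at_node _ hz,
    mul_div_cancel_left₀ _ (Lagrange.eval_nodal_not_at_node hz)]
  refine Finset.sum_congr rfl fun i hi => ?_
  rw [Lagrange.eval_interpolate_at_node _ hv hi, Lagrange.nodalWeight_eq_eval_derivative_nodal hi]
  ring

lemma nodal_add_C_mul_nodal_eq {a b : ι → K} {u : K} (hv : Set.InjOn v s)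
    (hroot : ∀ i ∈ s, (nodal s a + C u * nodal s b).eval (v i) = 0) :
    nodal s a + C u * nodal s b = C (1 + u) * nodal s v := by
  have hsub (w : ι → K) : (nodal s w - nodal s v).degree < s.card := by
    rw [← Lagrange.degree_nodal (v := w)]
    exact degree_sub_lt_left (by simp only [Lagrange.degree_nodal]) Lagrange.nodal_ne_zero
      (by simp only [Lagrange.nodal_monic.leadingCoeff])
  refine eq_of_degree_sub_lt_of_eval_index_eq s hv ?_ fun i hi => ?_
  · rw [show nodal s a + C u * nodal s b - C (1 + u) * nodal s v =
      (nodal s a - nodal s v) + u • (nodal s b - nodal s v) by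
        rw [smul_eq_C_mul, C_add, C_1]; ring]
    exact (degree_add_le _ _).trans_lt (max_lt (hsub a) ((degree_smul_le _ _).trans_lt (hsub b)))
  · rw [hroot i hi, eval_mul, Lagrange.eval_nodal_at_node hi, mul_zero]

end PartialFractions

section BandFamily

/-- The intervals `[l i, r i]` are nondegenerate and pairwise disjoint: the abstract form of the
subintervals of `E`. -/
structure IsBandFamily {ι : Type*} (l r : ι → ℝ) : Prop where
  lt : ∀ i, l i < r i
  lt_or_lt : Pairwise fun i j => r i < l j ∨ r j < l i

/-- The rational function `-∏ (x - r i) / ∏ (x - l i)`, which on each of the intervals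
`(l i, r i)` decreases from `∞` to `0`. -/
def bandMap {ι : Type*} [Fintype ι] (l r : ι → ℝ) (x : ℝ) : ℝ :=
  -((nodal univ r).eval x / (nodal univ l).eval x)

/-- The inverse `(0, ∞) → (l i, r i)` of `bandMap`. -/
def bandInv {ι : Type*} [Fintype ι] (l r : ι → ℝ) (i : ι) : ℝ → ℝ :=
  invFunOn (bandMap l r) (Set.Ioo (l i) (r i))

namespace IsBandFamily

variable {ι : Type*} {l r : ι → ℝ}

lemma pairwise_disjoint (h : IsBandFamily l r) :
    Pairwise (Disjoint on fun i => Set.Icc (l i) (r i)) := fun i j hij => by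
  refine Set.disjoint_left.mpr fun x hi hj => ?_
  rcases h.lt_or_lt hij with hlt | hlt
  · exact absurd (hj.1.trans hi.2) hlt.not_ge
  · exact absurd (hi.1.trans hj.2) hlt.not_ge

lemma left_injective (h : IsBandFamily l r) : Injective l := fun i j hij => by
  by_contra hne
  have hi := h.lt i
  have hj := h.lt j
  rcases h.lt_or_lt hne with hlt | hlt <;> linarith

lemma sub_mul_sub_pos (h : IsBandFamily l r) {i : ι} {x : ℝ} (hx : x ∉ Set.Icc (l i) (r i)) :
    0 < (x - r i) * (x - l i) := by
  have hi := h.lt i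
  rcases lt_or_ge x (l i) with hlt | hge
  · exact mul_pos_of_neg_of_neg (by linarith) (by linarith)
  · have hgt : r i < x := not_le.mp fun hle => hx ⟨hge, hle⟩
    exact mul_pos (by linarith) (by linarith)

variable [Fintype ι] {i : ι} {x : ℝ}

/-- Only the `i`-th of the factors `(x - r j) * (x - l j)` is not positive on `[l i, r i]`. -/
lemma exists_eval_nodal_mul_nodal_eq (h : IsBandFamily l r) (hx : x ∈ Set.Icc (l i) (r i)) :
    ∃ c > 0, (nodal univ r * nodal univ l).eval x = (x - r i) * (x - l i) * c := by
  classical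
  refine ⟨∏ j ∈ univ.erase i, (x - r j) * (x - l j), Finset.prod_pos fun j hj => ?_, ?_⟩
  · exact h.sub_mul_sub_pos
      (Set.disjoint_right.mp (h.pairwise_disjoint (Finset.ne_of_mem_erase hj)) hx)
  · rw [eval_mul, Lagrange.eval_nodal, Lagrange.eval_nodal, ← Finset.prod_mul_distrib,
      Finset.mul_prod_erase univ (fun j => (x - r j) * (x - l j)) (Finset.mem_univ i)]

lemma eval_nodal_mul_nodal_neg (h : IsBandFamily l r) (hx : x ∈ Set.Ioo (l i) (r i)) :
    (nodal univ r).eval x * (nodal univ l).eval x < 0 := by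
  obtain ⟨c, hc, heq⟩ := h.exists_eval_nodal_mul_nodal_eq (Set.Ioo_subset_Icc_self hx)
  rw [← eval_mul, heq]
  exact mul_neg_of_neg_of_pos (mul_neg_of_neg_of_pos (by linarith [hx.2]) (by linarith [hx.1])) hc

lemma eval_nodal_mul_nodal_nonpos_iff (h : IsBandFamily l r) :
    (nodal univ r * nodal univ l).eval x ≤ 0 ↔ x ∈ ⋃ i, Set.Icc (l i) (r i) := by
  refine ⟨fun hx => ?_, fun hx => ?_⟩
  · by_contra hmem
    refine hx.not_gt ?_
    rw [eval_mul, Lagrange.eval_nodal, Lagrange.eval_nodal, ← Finset.prod_mul_distrib]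
    exact Finset.prod_pos fun i _ => h.sub_mul_sub_pos fun hi => hmem (Set.mem_iUnion_of_mem i hi)
  · obtain ⟨i, hi⟩ := Set.mem_iUnion.mp hx
    obtain ⟨c, hc, heq⟩ := h.exists_eval_nodal_mul_nodal_eq hi
    rw [heq]
    exact mul_nonpos_of_nonpos_of_nonneg (mul_nonpos_of_nonpos_of_nonneg (by linarith [hi.2])
      (by linarith [hi.1])) hc.le

lemma eval_nodal_left_ne_zero (h : IsBandFamily l r) (hx : x ∈ Set.Ioo (l i) (r i)) :
    (nodal univ l).eval x ≠ 0 :=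
  right_ne_zero_of_mul (h.eval_nodal_mul_nodal_neg hx).ne

lemma bandMap_pos (h : IsBandFamily l r) (hx : x ∈ Set.Ioo (l i) (r i)) : 0 < bandMap l r x :=
  neg_pos.mpr ((div_neg_iff.trans mul_neg_iff.symm).mpr (h.eval_nodal_mul_nodal_neg hx))

lemma exists_bandMap_eq_sum (h : IsBandFamily l r) :
    ∃ c : ι → ℝ, (∀ i, 0 < c i) ∧
      ∀ x, (∀ i, x ≠ l i) → bandMap l r x = -1 + ∑ i, c i / (x - l i) := by
  classical
  refine ⟨fun i => -(nodal univ r).eval (l i) / (nodal univ l).derivative.eval (l i),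
    fun i => ?_, fun x hx => ?_⟩
  · beta_reduce
    rw [Lagrange.eval_nodal_derivative_eval_node_eq (Finset.mem_univ i), Lagrange.eval_nodal,
      Lagrange.eval_nodal, ← Finset.mul_prod_erase _ _ (Finset.mem_univ i), ← neg_mul,
      mul_div_assoc, ← Finset.prod_div_distrib]
    refine mul_pos (by linarith [h.lt i]) (Finset.prod_pos fun j hj => ?_)
    refine (div_pos_iff.trans mul_pos_iff.symm).mpr (h.sub_mul_sub_pos ?_)
    exact Set.disjoint_right.mp (h.pairwise_disjoint (Finset.ne_of_mem_erase hj))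
      (Set.left_mem_Icc.mpr (h.lt i).le)
  · have hdeg : (nodal univ l - nodal univ r).degree < (univ : Finset ι).card := by
      rw [← Lagrange.degree_nodal (v := l)]
      exact degree_sub_lt_left (by simp only [Lagrange.degree_nodal]) Lagrange.nodal_ne_zero
        (by simp only [Lagrange.nodal_monic.leadingCoeff])
    have hfrac := eval_div_eval_nodal h.left_injective.injOn hdeg fun i _ => hx i
    simp only [eval_sub, Lagrange.eval_nodal_at_node (Finset.mem_univ _), zero_sub] at hfrac
    have hne : (nodal univ l).eval x ≠ 0 := Lagrange.eval_nodal_not_at_node fun i _ => hx i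
    rw [← hfrac, sub_div, div_self hne, bandMap]
    ring

lemma differentiableAt_bandMap (h : IsBandFamily l r) (hx : x ∈ Set.Ioo (l i) (r i)) :
    DifferentiableAt ℝ (bandMap l r) x :=
  ((nodal univ r).differentiableAt.div (nodal univ l).differentiableAt
    (h.eval_nodal_left_ne_zero hx)).neg

lemma deriv_bandMap_neg (h : IsBandFamily l r) (hx : x ∈ Set.Ioo (l i) (r i)) :
    deriv (bandMap l r) x < 0 := by
  obtain ⟨c, hc, heq⟩ := h.exists_bandMap_eq_sum
  have hne (j : ι) : x ≠ l j := by
    rintro rfl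
    exact h.eval_nodal_left_ne_zero hx (Lagrange.eval_nodal_at_node (Finset.mem_univ j))
  have hloc : bandMap l r =ᶠ[𝓝 x] fun y => -1 + ∑ j, c j / (y - l j) :=
    (eventually_all.mpr fun j => eventually_ne_nhds (hne j)).mono heq
  have hderiv : HasDerivAt (fun y => -1 + ∑ j, c j / (y - l j)) (∑ j, -(c j / (x - l j) ^ 2)) x :=
    (HasDerivAt.fun_sum fun j _ => ((hasDerivAt_id x).sub_const (l j)).fun_inv
      (sub_ne_zero.mpr (hne j)) |>.const_mul (c j) |>.congr_deriv (by simp; ring)).const_add (-1)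
  rw [hloc.deriv_eq, hderiv.deriv]
  exact Finset.sum_neg (fun j _ => neg_neg_of_pos
    (div_pos (hc j) (sq_pos_of_ne_zero (sub_ne_zero.mpr (hne j))))) ⟨i, Finset.mem_univ i⟩

lemma strictAntiOn_bandMap (h : IsBandFamily l r) (i : ι) :
    StrictAntiOn (bandMap l r) (Set.Ioo (l i) (r i)) :=
  strictAntiOn_of_deriv_neg (convex_Ioo _ _)
    (fun _ hx => (h.differentiableAt_bandMap hx).continuousAt.continuousWithinAt)
    fun _ hx => h.deriv_bandMap_neg (interior_subset hx)

lemma eval_left_mul_eval_right_neg (h : IsBandFamily l r) (i : ι) :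
    (nodal univ r).eval (l i) * (nodal univ l).eval (r i) < 0 := by
  classical
  have hi := h.lt i
  rw [Lagrange.eval_nodal, Lagrange.eval_nodal, ← Finset.prod_mul_distrib,
    ← Finset.mul_prod_erase _ _ (Finset.mem_univ i)]
  refine mul_neg_of_neg_of_pos (mul_neg_of_neg_of_pos (by linarith) (by linarith))
    (Finset.prod_pos fun j hj => ?_)
  have hj' := h.lt j
  rcases h.lt_or_lt (Finset.ne_of_mem_erase hj) with hlt | hlt
  · exact mul_pos (by linarith) (by linarith)
  · exact mul_pos_of_neg_of_neg (by linarith) (by linarith)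

lemma bandMap_eq_iff (h : IsBandFamily l r) (hx : x ∈ Set.Ioo (l i) (r i)) {u : ℝ} :
    bandMap l r x = u ↔ (nodal univ r + C u * nodal univ l).eval x = 0 := by
  rw [bandMap, ← neg_div, div_eq_iff (h.eval_nodal_left_ne_zero hx), eval_add, eval_C_mul,
    neg_eq_iff_add_eq_zero]

lemma surjOn_bandMap (h : IsBandFamily l r) (i : ι) :
    Set.SurjOn (bandMap l r) (Set.Ioo (l i) (r i)) (Set.Ioi 0) := by
  intro u (hu : 0 < u)
  set f : ℝ → ℝ := fun x => (nodal univ r + C u * nodal univ l).eval x with hf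
  have hl : f (l i) = (nodal univ r).eval (l i) := by
    simp [hf, Lagrange.eval_nodal_at_node (Finset.mem_univ i)]
  have hr : f (r i) = u * (nodal univ l).eval (r i) := by
    simp [hf, Lagrange.eval_nodal_at_node (Finset.mem_univ i)]
  have hneg : f (l i) * f (r i) < 0 := by
    rw [hl, hr, mul_left_comm]
    exact mul_neg_of_pos_of_neg hu (h.eval_left_mul_eval_right_neg i)
  have hcont : ContinuousOn f (Set.Icc (l i) (r i)) := by fun_prop
  have hroot : (0 : ℝ) ∈ f '' Set.Ioo (l i) (r i) := by
    rcases mul_neg_iff.mp hneg with ⟨hpos, hneg⟩ | ⟨hneg, hpos⟩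
    · exact intermediate_value_Ioo' (h.lt i).le hcont ⟨hneg, hpos⟩
    · exact intermediate_value_Ioo (h.lt i).le hcont ⟨hneg, hpos⟩
  obtain ⟨x, hx, hx0⟩ := hroot
  exact ⟨x, hx, (h.bandMap_eq_iff hx).mpr hx0⟩

lemma bijOn_bandMap (h : IsBandFamily l r) (i : ι) :
    Set.BijOn (bandMap l r) (Set.Ioo (l i) (r i)) (Set.Ioi 0) :=
  ⟨fun _ hx => h.bandMap_pos hx, (h.strictAntiOn_bandMap i).injOn, h.surjOn_bandMap i⟩

variable {u : ℝ}

lemma bandInv_mem (h : IsBandFamily l r) (i : ι) (hu : 0 < u) :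
    bandInv l r i u ∈ Set.Ioo (l i) (r i) :=
  (h.surjOn_bandMap i).mapsTo_invFunOn hu

lemma bandMap_bandInv (h : IsBandFamily l r) (i : ι) (hu : 0 < u) :
    bandMap l r (bandInv l r i u) = u :=
  (h.bijOn_bandMap i).invOn_invFunOn.2 hu

lemma bandInv_bandMap (h : IsBandFamily l r) (hx : x ∈ Set.Ioo (l i) (r i)) :
    bandInv l r i (bandMap l r x) = x :=
  (h.bijOn_bandMap i).invOn_invFunOn.1 hx

lemma antitoneOn_bandInv (h : IsBandFamily l r) (i : ι) :
    AntitoneOn (bandInv l r i) (Set.Ioi 0) := by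
  intro u (hu : 0 < u) v (hv : 0 < v) huv
  rwa [← (h.strictAntiOn_bandMap i).le_iff_ge (h.bandInv_mem i hu) (h.bandInv_mem i hv),
    h.bandMap_bandInv i hu, h.bandMap_bandInv i hv]

lemma bandInv_injective (h : IsBandFamily l r) (hu : 0 < u) :
    Injective fun i => bandInv l r i u := fun i j hij => by
  by_contra hne
  refine Set.disjoint_left.mp (h.pairwise_disjoint hne)
    (Set.Ioo_subset_Icc_self (h.bandInv_mem i hu)) ?_
  exact (show bandInv l r i u = bandInv l r j u from hij) ▸
    Set.Ioo_subset_Icc_self (h.bandInv_mem j hu)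

lemma nodal_add_C_mul_nodal_eq_bandInv (h : IsBandFamily l r) (hu : 0 < u) :
    nodal univ r + C u * nodal univ l = C (1 + u) * nodal univ fun i => bandInv l r i u :=
  nodal_add_C_mul_nodal_eq (h.bandInv_injective hu).injOn fun i _ =>
    (h.bandMap_eq_iff (h.bandInv_mem i hu)).mp (h.bandMap_bandInv i hu)

lemma eval_derivative_nodal_add (h : IsBandFamily l r) (hx : x ∈ Set.Ioo (l i) (r i)) :
    (nodal univ r + C (bandMap l r x) * nodal univ l).derivative.eval x =
      -deriv (bandMap l r) x * (nodal univ l).eval x := by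
  have hne := h.eval_nodal_left_ne_zero hx
  have hderiv := (((nodal univ r).hasDerivAt x).fun_div ((nodal univ l).hasDerivAt x) hne).fun_neg
  rw [show bandMap l r = fun y => -((nodal univ r).eval y / (nodal univ l).eval y) from rfl,
    hderiv.deriv]
  simp only [derivative_add, derivative_C_mul, eval_add, eval_C_mul]
  field_simp
  ring

end IsBandFamily

end BandFamily

section StieltjesOfWeight

lemma integral_inv_sqrt_div {a b : ℝ} (ha : 0 < a) (hb : 0 < b) :
    IntegrableOn (fun u : ℝ => (√u)⁻¹ / (a + b * u)) (Set.Ioi 0) ∧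
      ∫ u in Set.Ioi (0 : ℝ), (√u)⁻¹ / (a + b * u) = Real.pi / √(a * b) := by
  set G : ℝ → ℝ := fun u => 2 / √(a * b) * Real.arctan (√(b / a) * √u) with hG
  have hcont : ContinuousWithinAt G (Set.Ici 0) 0 :=
    Continuous.continuousWithinAt (by fun_prop)
  have hderiv : ∀ u ∈ Set.Ioi (0 : ℝ), HasDerivAt G ((√u)⁻¹ / (a + b * u)) u := by
    intro u (hu : 0 < u)
    refine ((((Real.hasDerivAt_sqrt hu.ne').const_mul √(b / a)).arctan).const_mul
      (2 / √(a * b))).congr_deriv ?_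
    have hsqrt : √(a * b) = a * √(b / a) := by
      rw [show a * b = a ^ 2 * (b / a) by field_simp, Real.sqrt_mul (by positivity),
        Real.sqrt_sq ha.le]
    rw [mul_pow, Real.sq_sqrt (div_pos hb ha).le, Real.sq_sqrt hu.le, hsqrt]
    have : 0 < √u := Real.sqrt_pos.mpr hu
    have : 0 < √(b / a) := Real.sqrt_pos.mpr (div_pos hb ha)
    have : 0 < a + b * u := by positivity
    field_simp
  have hnonneg : ∀ u ∈ Set.Ioi (0 : ℝ), 0 ≤ (√u)⁻¹ / (a + b * u) := by
    intro u (hu : 0 < u)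
    positivity
  have hlim : Tendsto G atTop (𝓝 (Real.pi / √(a * b))) := by
    have harg : Tendsto (fun u : ℝ => √(b / a) * √u) atTop atTop :=
      Real.tendsto_sqrt_atTop.const_mul_atTop (Real.sqrt_pos.mpr (div_pos hb ha))
    have hmul := ((Real.tendsto_arctan_atTop.mono_right nhdsWithin_le_nhds).comp harg).const_mul
      (2 / √(a * b))
    rwa [show 2 / √(a * b) * (Real.pi / 2) = Real.pi / √(a * b) by ring] at hmul
  refine ⟨integrableOn_Ioi_deriv_of_nonneg hcont hderiv hnonneg hlim, ?_⟩
  rw [integral_Ioi_of_hasDerivAt_of_nonneg hcont hderiv hnonneg hlim]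
  simp [hG]

namespace IsBandFamily

open ENNReal

variable {ι : Type*} [Fintype ι] {l r : ι → ℝ}

lemma lintegral_Icc_eq_lintegral_bandInv (h : IsBandFamily l r) (i : ι) (f : ℝ → ℝ≥0∞) :
    ∫⁻ x in Set.Icc (l i) (r i), f x =
      ∫⁻ u in Set.Ioi 0, ENNReal.ofReal |deriv (bandMap l r) (bandInv l r i u)|⁻¹ *
        f (bandInv l r i u) := by
  rw [setLIntegral_congr Ioo_ae_eq_Icc.symm, ← (h.bijOn_bandMap i).image_eq,
    lintegral_image_eq_lintegral_abs_deriv_mul measurableSet_Ioo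
      (fun x hx => (h.differentiableAt_bandMap hx).hasDerivAt.hasDerivWithinAt)
      (h.strictAntiOn_bandMap i).injOn]
  refine setLIntegral_congr_fun measurableSet_Ioo fun x hx => ?_
  have hderiv : 0 < |deriv (bandMap l r) x| := abs_pos.mpr (h.deriv_bandMap_neg hx).ne
  rw [h.bandInv_bandMap hx, ← mul_assoc, ← ENNReal.ofReal_mul hderiv.le,
    mul_inv_cancel₀ hderiv.ne', ENNReal.ofReal_one, one_mul]

lemma aemeasurable_bandInv (h : IsBandFamily l r) (i : ι) :
    AEMeasurable (bandInv l r i) (volume.restrict (Set.Ioi 0)) :=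
  aemeasurable_restrict_of_antitoneOn measurableSet_Ioi (h.antitoneOn_bandInv i)

lemma lintegral_iUnion_eq_lintegral_sum_bandInv (h : IsBandFamily l r) {f : ℝ → ℝ≥0∞}
    (hf : Measurable f) :
    ∫⁻ x in ⋃ i, Set.Icc (l i) (r i), f x =
      ∫⁻ u in Set.Ioi 0, ∑ i, ENNReal.ofReal |deriv (bandMap l r) (bandInv l r i u)|⁻¹ *
        f (bandInv l r i u) := by
  rw [lintegral_iUnion (fun _ => measurableSet_Icc) h.pairwise_disjoint, tsum_fintype,
    lintegral_finsetSum']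
  · exact Finset.sum_congr rfl fun i _ => h.lintegral_Icc_eq_lintegral_bandInv i f
  · exact fun i _ => ((measurable_deriv _).comp_aemeasurable (h.aemeasurable_bandInv i)).abs.inv
      |>.ennreal_ofReal.mul (hf.comp_aemeasurable (h.aemeasurable_bandInv i))

variable {m : ι} {z u : ℝ}

lemma bandInv_lt (h : IsBandFamily l r) (hm : ∀ i, r i ≤ r m) (i : ι) (hu : 0 < u) :
    bandInv l r i u < r m :=
  (h.bandInv_mem i hu).2.trans_le (hm i)

variable [DecidableEq ι]

lemma eval_nodal_erase_div_eval_derivative (h : IsBandFamily l r) (hm : ∀ i, r i ≤ r m) (i : ι)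
    (hu : 0 < u) :
    (nodal (univ.erase m) r).eval (bandInv l r i u) /
        (nodal univ fun j => bandInv l r j u).derivative.eval (bandInv l r i u) / (1 + u) =
      |deriv (bandMap l r) (bandInv l r i u)|⁻¹ * (u / (r m - bandInv l r i u)) := by
  set x := bandInv l r i u
  have hmem : x ∈ Set.Ioo (l i) (r i) := h.bandInv_mem i hu
  have hval : bandMap l r x = u := h.bandMap_bandInv i hu
  have hderiv := h.eval_derivative_nodal_add hmem
  rw [hval, h.nodal_add_C_mul_nodal_eq_bandInv hu, derivative_C_mul, eval_C_mul] at hderiv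
  have hroot := (h.bandMap_eq_iff hmem).mp hval
  rw [Lagrange.nodal_eq_mul_nodal_erase (Finset.mem_univ m), eval_add, eval_C_mul, eval_mul,
    eval_sub, eval_X, eval_C] at hroot
  have hne := h.eval_nodal_left_ne_zero hmem
  have hneg := h.deriv_bandMap_neg hmem
  have hsub := (sub_pos.mpr (h.bandInv_lt hm i hu)).ne'
  have hnum : (nodal (univ.erase m) r).eval x = u * (nodal univ l).eval x / (r m - x) := by
    rw [_root_.eq_div_iff hsub]
    linear_combination -hroot
  rw [hnum, abs_of_neg hneg, div_div, mul_comm _ (1 + u), hderiv]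
  have := hneg.ne
  field_simp

lemma eval_nodal_erase_div_eq_sum (h : IsBandFamily l r) (hm : ∀ i, r i ≤ r m) (hz : r m < z)
    (hu : 0 < u) :
    (nodal (univ.erase m) r).eval z / ((nodal univ r).eval z + u * (nodal univ l).eval z) =
      ∑ i, |deriv (bandMap l r) (bandInv l r i u)|⁻¹ *
        (u / (r m - bandInv l r i u) / (z - bandInv l r i u)) := by
  have hdeg : (nodal (univ.erase m) r).degree < (univ : Finset ι).card := by
    rw [Lagrange.degree_nodal]
    exact_mod_cast Finset.card_erase_lt_of_mem (Finset.mem_univ m)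
  have hfrac := eval_div_eval_nodal (h.bandInv_injective hu).injOn hdeg
    fun i _ => ((h.bandInv_lt hm i hu).trans hz).ne'
  rw [← eval_C_mul, ← eval_add, h.nodal_add_C_mul_nodal_eq_bandInv hu, eval_C_mul, mul_comm,
    ← div_div, hfrac, Finset.sum_div]
  refine Finset.sum_congr rfl fun i _ => ?_
  rw [div_right_comm, h.eval_nodal_erase_div_eval_derivative hm i hu, mul_div_assoc]

lemma sum_ofReal_bandInv (h : IsBandFamily l r) (hm : ∀ i, r i ≤ r m) (hz : r m < z)
    (hu : 0 < u) :
    ∑ i, ENNReal.ofReal |deriv (bandMap l r) (bandInv l r i u)|⁻¹ *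
        ENNReal.ofReal (√(bandMap l r (bandInv l r i u)) / (r m - bandInv l r i u) /
          (z - bandInv l r i u)) =
      ENNReal.ofReal ((nodal (univ.erase m) r).eval z *
        ((√u)⁻¹ / ((nodal univ r).eval z + (nodal univ l).eval z * u))) := by
  have hx (i : ι) : bandInv l r i u < r m := h.bandInv_lt hm i hu
  simp only [← ENNReal.ofReal_mul (inv_nonneg.mpr (abs_nonneg _))]
  rw [← ENNReal.ofReal_sum_of_nonneg fun i _ => mul_nonneg (inv_nonneg.mpr (abs_nonneg _))
      (div_nonneg (div_nonneg (Real.sqrt_nonneg _) (sub_pos.mpr (hx i)).le)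
        (sub_pos.mpr ((hx i).trans hz)).le),
    mul_div_left_comm, mul_comm ((nodal univ l).eval z), h.eval_nodal_erase_div_eq_sum hm hz hu,
    Finset.mul_sum]
  congr! 2 with i
  have hsqrt : √u = u * (√u)⁻¹ := Real.div_sqrt.symm
  rw [h.bandMap_bandInv i hu]
  linear_combination (|deriv (bandMap l r) (bandInv l r i u)|⁻¹ / (r m - bandInv l r i u) /
    (z - bandInv l r i u)) * hsqrt

lemma lintegral_sqrt_bandMap_div (h : IsBandFamily l r) (hm : ∀ i, r i ≤ r m) (hz : r m < z) :
    ∫⁻ x in ⋃ i, Set.Icc (l i) (r i), ENNReal.ofReal (√(bandMap l r x) / (r m - x) / (z - x)) =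
      ENNReal.ofReal (Real.pi * ((nodal (univ.erase m) r).eval z /
        √((nodal univ r).eval z * (nodal univ l).eval z))) := by
  have hpos (s : Finset ι) {v : ι → ℝ} (hv : ∀ i, v i < z) : 0 < (nodal s v).eval z := by
    rw [Lagrange.eval_nodal]
    exact Finset.prod_pos fun i _ => sub_pos.mpr (hv i)
  have hrz (i : ι) : r i < z := (hm i).trans_lt hz
  have hnum := hpos (univ.erase m) hrz
  have hr := hpos univ hrz
  have hl := hpos univ fun i => (h.lt i).trans (hrz i)
  obtain ⟨hint, hval⟩ := integral_inv_sqrt_div hr hl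
  have hmeas : Measurable fun x => ENNReal.ofReal (√(bandMap l r x) / (r m - x) / (z - x)) := by
    unfold bandMap
    fun_prop
  rw [h.lintegral_iUnion_eq_lintegral_sum_bandInv hmeas,
    setLIntegral_congr_fun measurableSet_Ioi fun u hu => h.sum_ofReal_bandInv hm hz hu,
    ← ofReal_integral_eq_lintegral_ofReal (hint.const_mul _), integral_const_mul, hval,
    mul_div_left_comm]
  filter_upwards [ae_restrict_mem measurableSet_Ioi] with u (hu : 0 < u)
  positivity

end IsBandFamily

end StieltjesOfWeight

section OrthogonalSequence

/-- `P` is the sequence of monic orthogonal polynomials of the linear functional `L`, which plays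
the role of integration against a measure. -/
structure IsOrthogonalSequence (L : ℝ[X] →ₗ[ℝ] ℝ) (P : ℕ → ℝ[X]) : Prop where
  monic : ∀ n, (P n).Monic
  natDegree_eq : ∀ n, (P n).natDegree = n
  map_mul : ∀ m n, m ≠ n → L (P m * P n) = 0

variable {L : ℝ[X] →ₗ[ℝ] ℝ} {P : ℕ → ℝ[X]} {a b : ℕ → ℝ}

namespace IsOrthogonalSequence

lemma apply_zero (hP : IsOrthogonalSequence L P) : P 0 = 1 :=
  (hP.monic 0).natDegree_eq_zero.mp (hP.natDegree_eq 0)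

lemma degree_eq (hP : IsOrthogonalSequence L P) (n : ℕ) : (P n).degree = n := by
  rw [degree_eq_natDegree (hP.monic n).ne_zero, hP.natDegree_eq]

lemma map_mul_eq_zero (hP : IsOrthogonalSequence L P) {n : ℕ} {q : ℝ[X]} (hq : q.degree < n) :
    L (q * P n) = 0 := by
  let S : Polynomial.Sequence ℝ := ⟨P, hP.degree_eq⟩
  have hspan : q ∈ Submodule.span ℝ (P '' Set.Iio n) := by
    rwa [← mem_degreeLT, ← S.span_degreeLT fun i _ => (hP.monic i).leadingCoeff ▸ isUnit_one] at hq
  clear hq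
  induction hspan using Submodule.span_induction with
  | mem _ hx =>
    obtain ⟨m, hm, rfl⟩ := hx
    exact hP.map_mul m n (ne_of_lt hm)
  | zero => rw [zero_mul, map_zero]
  | add _ _ _ _ hx hy => rw [add_mul, map_add, hx, hy, add_zero]
  | smul c _ _ hx => rw [smul_mul_assoc, map_smul, hx, smul_zero]

lemma map_self_succ (hP : IsOrthogonalSequence L P) (hab : IsRecurrence P a b) (n : ℕ) :
    L (P (n + 1) * P (n + 1)) = a (n + 1) * L (P n * P n) := by
  have hdeg : (X * P n).degree = ((n + 1 : ℕ) : WithBot ℕ) := by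
    rw [degree_mul, degree_X, hP.degree_eq, add_comm, Nat.cast_succ]
  have hlt : (P (n + 1) - X * P n).degree < ((n + 1 : ℕ) : WithBot ℕ) := by
    rw [← hP.degree_eq (n + 1)]
    exact degree_sub_lt_left (by rw [hP.degree_eq, hdeg]) (hP.monic _).ne_zero
      (by rw [(hP.monic _).leadingCoeff, (monic_X.mul (hP.monic n)).leadingCoeff])
  have hsplit : P (n + 1) * P (n + 1) = (P (n + 1) - X * P n) * P (n + 1) + P n * P (n + 2) +
      b (n + 2) • (P n * P (n + 1)) + a (n + 1) • (P n * P n) := by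
    rw [smul_eq_C_mul, smul_eq_C_mul]
    linear_combination P n * hab.succ n
  rw [hsplit]
  simp only [map_add, map_smul, hP.map_mul_eq_zero hlt, hP.map_mul n (n + 2) (by lia),
    hP.map_mul n (n + 1) (by lia), smul_eq_mul]
  ring

lemma map_self_eq_prod (hP : IsOrthogonalSequence L P) (hab : IsRecurrence P a b) (hL : L 1 = 1)
    (n : ℕ) : L (P n * P n) = ∏ i ∈ Finset.range n, a (i + 1) := by
  induction n with
  | zero => rw [hP.apply_zero, mul_one, hL, Finset.prod_range_zero]
  | succ n ih => rw [hP.map_self_succ hab, ih, Finset.prod_range_succ, mul_comm]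

lemma coeff_pos (hP : IsOrthogonalSequence L P) (hab : IsRecurrence P a b)
    (hL : ∀ p ≠ 0, 0 < L (p * p)) (n : ℕ) : 0 < a (n + 1) := by
  have hsucc := hL _ (hP.monic (n + 1)).ne_zero
  rw [hP.map_self_succ hab] at hsucc
  exact pos_of_mul_pos_left hsucc (hL _ (hP.monic n).ne_zero).le

end IsOrthogonalSequence

end OrthogonalSequence

section StieltjesTransform

variable {μ : Measure ℝ} {R z : ℝ}

/-- The function of the second kind `∫ p(x) / (z - x) dμ(x)` of the polynomial `p`; for `p = 1` it
is the Stieltjes transform of `μ`. -/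
def stieltjes (μ : Measure ℝ) (p : ℝ[X]) (z : ℝ) : ℝ :=
  ∫ x, p.eval x / (z - x) ∂μ

lemma stieltjes_C_mul (c : ℝ) (p : ℝ[X]) : stieltjes μ (C c * p) z = c * stieltjes μ p z := by
  simp only [stieltjes, eval_C_mul, mul_div_assoc]
  exact integral_const_mul c _

variable [IsFiniteMeasure μ]

lemma integrable_of_continuousOn (hμ : ∀ᵐ x ∂μ, x ∈ Set.Icc (-R) R) {f : ℝ → ℝ}
    (hf : ContinuousOn f (Set.Icc (-R) R)) : Integrable f μ := by
  rw [← Measure.restrict_eq_self_of_ae_mem hμ]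
  exact hf.integrableOn_compact isCompact_Icc

lemma integrable_eval (hμ : ∀ᵐ x ∂μ, x ∈ Set.Icc (-R) R) (p : ℝ[X]) :
    Integrable (fun x => p.eval x) μ :=
  integrable_of_continuousOn hμ p.continuousOn

lemma integrable_eval_div (hμ : ∀ᵐ x ∂μ, x ∈ Set.Icc (-R) R) (p : ℝ[X]) (hz : R < z) :
    Integrable (fun x => p.eval x / (z - x)) μ :=
  integrable_of_continuousOn hμ <| p.continuousOn.div (by fun_prop) fun x hx => by linarith [hx.2]

/-- Integration of polynomials against a measure supported in `[-R, R]`. -/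
def moment (hμ : ∀ᵐ x ∂μ, x ∈ Set.Icc (-R) R) : ℝ[X] →ₗ[ℝ] ℝ where
  toFun p := ∫ x, p.eval x ∂μ
  map_add' p q := by
    simp only [eval_add]
    exact integral_add (integrable_eval hμ p) (integrable_eval hμ q)
  map_smul' c p := by
    simp only [eval_smul]
    exact integral_smul c _

lemma moment_mul_self_pos [NullSingletonClass μ] [NeZero μ]
    (hμ : ∀ᵐ x ∂μ, x ∈ Set.Icc (-R) R) {p : ℝ[X]} (hp : p ≠ 0) : 0 < moment hμ (p * p) := by
  have hnonneg (x : ℝ) : 0 ≤ (p * p).eval x := eval_mul.trans_ge (mul_self_nonneg _)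
  refine (integral_pos_iff_support_of_nonneg hnonneg (integrable_eval hμ _)).mpr ?_
  have hroots : support (fun x => (p * p).eval x) = (p.roots.toFinset : Set ℝ)ᶜ := by
    ext x
    simp [hp]
  rw [hroots, measure_compl (Finset.measurableSet _) (measure_ne_top _ _), Finset.measure_zero,
    tsub_zero]
  exact Measure.measure_univ_pos.mpr (NeZero.ne μ)

lemma stieltjes_add (hμ : ∀ᵐ x ∂μ, x ∈ Set.Icc (-R) R) (p q : ℝ[X]) (hz : R < z) :
    stieltjes μ (p + q) z = stieltjes μ p z + stieltjes μ q z := by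
  simp only [stieltjes, eval_add, add_div]
  exact integral_add (integrable_eval_div hμ p hz) (integrable_eval_div hμ q hz)

lemma stieltjes_X_mul (hμ : ∀ᵐ x ∂μ, x ∈ Set.Icc (-R) R) (p : ℝ[X]) (hz : R < z) :
    stieltjes μ (X * p) z = z * stieltjes μ p z - moment hμ p := by
  change ∫ x, _ ∂μ = z * ∫ x, _ ∂μ - ∫ x, p.eval x ∂μ
  rw [← integral_const_mul, ← integral_sub ((integrable_eval_div hμ p hz).const_mul z)
    (integrable_eval hμ p)]
  refine integral_congr_ae ?_
  filter_upwards [hμ] with x hx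
  have hne : z - x ≠ 0 := by linarith [hx.2]
  rw [eval_mul, eval_X]
  field_simp
  ring

lemma tendsto_stieltjes (hμ : ∀ᵐ x ∂μ, x ∈ Set.Icc (-R) R) (p : ℝ[X]) :
    Tendsto (stieltjes μ p) atTop (𝓝 0) := by
  have hbound (z : ℝ) (hz : R < z) :
      ‖stieltjes μ p z‖ ≤ (z - R)⁻¹ * ∫ x, ‖p.eval x‖ ∂μ := by
    rw [← integral_const_mul]
    refine norm_integral_le_of_norm_le ((integrable_eval hμ p).norm.const_mul _) ?_
    filter_upwards [hμ] with x hx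
    rw [norm_div, div_eq_inv_mul, Real.norm_of_nonneg (by linarith [hx.2] : 0 ≤ z - x)]
    gcongr
    exact hx.2
  have hlim : Tendsto (fun z : ℝ => (z - R)⁻¹ * ∫ x, ‖p.eval x‖ ∂μ) atTop (𝓝 0) := by
    rw [← zero_mul (∫ x, ‖p.eval x‖ ∂μ)]
    exact (tendsto_atTop_add_const_right atTop (-R) tendsto_id).inv_tendsto_atTop.mul_const _
  exact squeeze_zero_norm' ((eventually_gt_atTop R).mono hbound) hlim

lemma tendsto_mul_stieltjes_one (hμ : ∀ᵐ x ∂μ, x ∈ Set.Icc (-R) R) :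
    Tendsto (fun z => z * stieltjes μ 1 z) atTop (𝓝 (moment hμ 1)) := by
  have hlim := (tendsto_stieltjes hμ (X * 1)).add_const (moment hμ 1)
  rw [zero_add] at hlim
  refine hlim.congr' ?_
  filter_upwards [eventually_gt_atTop R] with z hz
  rw [stieltjes_X_mul hμ _ hz, sub_add_cancel]

lemma stieltjes_X_pow_mul (hμ : ∀ᵐ x ∂μ, x ∈ Set.Icc (-R) R) {p : ℝ[X]} {n : ℕ}
    (hp : ∀ i < n, moment hμ (X ^ i * p) = 0) (hz : R < z) :
    stieltjes μ (X ^ n * p) z = z ^ n * stieltjes μ p z := by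
  induction n with
  | zero => rw [pow_zero, one_mul, pow_zero, one_mul]
  | succ n ih =>
    rw [pow_succ', mul_assoc, stieltjes_X_mul hμ _ hz, hp n n.lt_succ_self,
      ih fun i hi => hp i (hi.trans n.lt_succ_self)]
    ring

variable {P : ℕ → ℝ[X]}

lemma IsOrthogonalSequence.tendsto_pow_mul_stieltjes (hμ : ∀ᵐ x ∂μ, x ∈ Set.Icc (-R) R)
    (hP : IsOrthogonalSequence (moment hμ) P) {m n : ℕ} (hmn : m ≤ n) :
    Tendsto (fun z => z ^ m * stieltjes μ (P n) z) atTop (𝓝 0) := by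
  refine (tendsto_stieltjes hμ (X ^ m * P n)).congr' ?_
  filter_upwards [eventually_gt_atTop R] with z hz
  refine stieltjes_X_pow_mul hμ (fun i hi => hP.map_mul_eq_zero ?_) hz
  rw [degree_X_pow]
  exact_mod_cast hi.trans_le hmn

end StieltjesTransform

section ChebyshevMeasure

variable {g : ℕ} {α β : Fin g → ℝ} {x z : ℝ}

lemma bandLeft_zero (β : Fin g → ℝ) : bandLeft β 0 = -1 := Fin.cons_zero _ _

lemma bandLeft_succ (β : Fin g → ℝ) (j : Fin g) : bandLeft β j.succ = β j := Fin.cons_succ _ _ j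

lemma bandRight_castSucc (α : Fin g → ℝ) (j : Fin g) : bandRight α j.castSucc = α j :=
  Fin.snoc_castSucc _ _ j

lemma bandRight_last (α : Fin g → ℝ) : bandRight α (Fin.last g) = 1 := Fin.snoc_last _ _

namespace IsBranchPoints

lemma bandRight_lt_bandLeft (h : IsBranchPoints α β) {i j : Fin (g + 1)} (hij : i < j) :
    bandRight α i < bandLeft β j := by
  have hmono : StrictMono (bandLeft β) := Fin.strictMono_iff_lt_succ.mpr fun k =>
    (h.band k.castSucc).trans <| by rw [bandRight_castSucc, bandLeft_succ]; exact h.gap k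
  obtain ⟨k, rfl⟩ := Fin.exists_castSucc_eq.mpr (Fin.ne_last_of_lt hij)
  rw [bandRight_castSucc]
  refine (h.gap k).trans_le ?_
  rw [← bandLeft_succ β]
  exact hmono.monotone (Fin.castSucc_lt_iff_succ_le.mp hij)

lemma isBandFamily (h : IsBranchPoints α β) : IsBandFamily (bandLeft β) (bandRight α) :=
  ⟨h.band, fun _ _ hij => hij.lt_or_gt.imp h.bandRight_lt_bandLeft h.bandRight_lt_bandLeft⟩

lemma neg_one_le_bandLeft (h : IsBranchPoints α β) (k : Fin (g + 1)) : -1 ≤ bandLeft β k := by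
  rw [← bandLeft_zero β]
  rcases (Fin.zero_le k).eq_or_lt with rfl | hlt
  · exact le_rfl
  · exact (h.band 0).le.trans (h.bandRight_lt_bandLeft hlt).le

lemma bandRight_le_one (h : IsBranchPoints α β) (k : Fin (g + 1)) : bandRight α k ≤ 1 := by
  rw [← bandRight_last α]
  rcases (Fin.le_last k).eq_or_lt with rfl | hlt
  · exact le_rfl
  · exact (h.bandRight_lt_bandLeft hlt).le.trans (h.band _).le

lemma E_subset (h : IsBranchPoints α β) : E α β ⊆ Set.Icc (-1) 1 :=
  Set.iUnion_subset fun k => Set.Icc_subset_Icc (h.neg_one_le_bandLeft k) (h.bandRight_le_one k)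

end IsBranchPoints

/-- `∏ (X - α j)`, the square of the Stieltjes transform of the weight being `numer / denom`. -/
def numer (α : Fin g → ℝ) : ℝ[X] := nodal univ α

/-- `(X - 1) (X + 1) ∏ (X - β j)`, the denominator going with `numer`. -/
def denom (β : Fin g → ℝ) : ℝ[X] := (X - C 1) * nodal univ (bandLeft β)

lemma monic_numer (α : Fin g → ℝ) : (numer α).Monic := Lagrange.nodal_monic

lemma natDegree_numer (α : Fin g → ℝ) : (numer α).natDegree = g := by
  rw [numer, Lagrange.natDegree_nodal, Finset.card_fin]

lemma monic_denom (β : Fin g → ℝ) : (denom β).Monic :=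
  (monic_X_sub_C 1).mul Lagrange.nodal_monic

lemma natDegree_denom (β : Fin g → ℝ) : (denom β).natDegree = g + 2 := by
  rw [denom, (monic_X_sub_C 1).natDegree_mul Lagrange.nodal_monic, natDegree_X_sub_C,
    Lagrange.natDegree_nodal, Finset.card_fin, add_comm]

lemma nodal_bandRight (α : Fin g → ℝ) : nodal univ (bandRight α) = numer α * (X - C 1) := by
  simp only [nodal, numer, Fin.prod_univ_castSucc, bandRight, Fin.snoc_castSucc, Fin.snoc_last]

lemma nodal_bandLeft (β : Fin g → ℝ) : nodal univ (bandLeft β) = (X - C (-1)) * nodal univ β := by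
  simp only [nodal, Fin.prod_univ_succ, bandLeft, Fin.cons_zero, Fin.cons_succ]

lemma nodal_erase_bandRight (α : Fin g → ℝ) :
    nodal (univ.erase (Fin.last g)) (bandRight α) = numer α := by
  refine mul_left_cancel₀ (X_sub_C_ne_zero 1) ?_
  rw [← bandRight_last α, ← Lagrange.nodal_eq_mul_nodal_erase (Finset.mem_univ _),
    nodal_bandRight, bandRight_last, mul_comm]

lemma nodal_mul_nodal (α β : Fin g → ℝ) :
    nodal univ (bandRight α) * nodal univ (bandLeft β) = numer α * denom β := by
  rw [nodal_bandRight, denom, mul_assoc]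

lemma IsBranchPoints.eval_nonpos_iff (h : IsBranchPoints α β) :
    (numer α * denom β).eval x ≤ 0 ↔ x ∈ E α β := by
  rw [← nodal_mul_nodal, h.isBandFamily.eval_nodal_mul_nodal_nonpos_iff]
  rfl

lemma eval_numer (α : Fin g → ℝ) : (numer α).eval x = ∏ j, (x - α j) := Lagrange.eval_nodal

lemma weight_eq (hx : x ≤ 1) :
    weight α β x = 1 / Real.pi * (√(bandMap (bandLeft β) (bandRight α) x) / (1 - x)) := by
  have hmap : bandMap (bandLeft β) (bandRight α) x =
      (numer α).eval x * (1 - x) / ((1 + x) * ∏ j, (x - β j)) := by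
    rw [bandMap, nodal_bandLeft, nodal_bandRight, eval_mul, eval_mul,
      Lagrange.eval_nodal (v := β)]
    simp only [eval_sub, eval_X, eval_C, sub_neg_eq_add]
    ring
  have hsqrt (y : ℝ) : √y / (1 - x) = √(y / (1 - x) ^ 2) := by
    rw [Real.sqrt_div' _ (sq_nonneg _), Real.sqrt_sq (sub_nonneg.mpr hx)]
  rw [weight, ← eval_numer, hsqrt, hmap, div_div,
    show (1 + x) * (∏ j, (x - β j)) * (1 - x) ^ 2 =
      ((1 - x ^ 2) * ∏ j, (x - β j)) * (1 - x) by ring]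
  rcases hx.eq_or_lt with rfl | hlt
  · norm_num
  · rw [mul_div_mul_right _ _ (sub_pos.mpr hlt).ne']

lemma measurable_weight (α β : Fin g → ℝ) : Measurable (weight α β) := by
  unfold weight
  fun_prop

lemma weight_nonneg (α β : Fin g → ℝ) (x : ℝ) : 0 ≤ weight α β x :=
  mul_nonneg (div_nonneg zero_le_one Real.pi_pos.le) (Real.sqrt_nonneg _)

lemma measurableSet_E (α β : Fin g → ℝ) : MeasurableSet (E α β) :=
  MeasurableSet.iUnion fun _ => measurableSet_Icc

/-- The measure `w dx` on `E`. -/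
def chebyshevMeasure (α β : Fin g → ℝ) : Measure ℝ :=
  (volume.restrict (E α β)).withDensity fun x => ENNReal.ofReal (weight α β x)

lemma integral_chebyshevMeasure (f : ℝ → ℝ) :
    ∫ x, f x ∂chebyshevMeasure α β = ∫ x in E α β, f x * weight α β x := by
  rw [chebyshevMeasure, integral_withDensity_eq_integral_toReal_smul
    (measurable_weight α β).ennreal_ofReal (by simp)]
  simp only [ENNReal.toReal_ofReal (weight_nonneg α β _), smul_eq_mul, mul_comm]

namespace IsBranchPoints

lemma ae_mem_Icc (h : IsBranchPoints α β) :
    ∀ᵐ x ∂chebyshevMeasure α β, x ∈ Set.Icc (-1 : ℝ) 1 :=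
  (withDensity_absolutelyContinuous _ _).ae_le <|
    (ae_restrict_mem (measurableSet_E α β)).mono fun _ hx => h.E_subset hx

lemma eval_numer_pos (h : IsBranchPoints α β) (hz : 1 < z) : 0 < (numer α).eval z := by
  rw [eval_numer]
  refine Finset.prod_pos fun j _ => ?_
  have hj := h.bandRight_le_one j.castSucc
  rw [bandRight_castSucc] at hj
  linarith

lemma eval_denom_pos (h : IsBranchPoints α β) (hz : 1 < z) : 0 < (denom β).eval z := by
  rw [denom, eval_mul, eval_sub, eval_X, eval_C, Lagrange.eval_nodal]
  refine mul_pos (sub_pos.mpr hz) (Finset.prod_pos fun k _ => ?_)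
  linarith [h.band k, h.bandRight_le_one k]

lemma lintegral_inv_sub (h : IsBranchPoints α β) (hz : 1 < z) :
    ∫⁻ x, ENNReal.ofReal (1 / (z - x)) ∂chebyshevMeasure α β =
      ENNReal.ofReal ((numer α).eval z / √((numer α * denom β).eval z)) := by
  have hband := h.isBandFamily.lintegral_sqrt_bandMap_div (m := Fin.last g) (z := z)
    (fun k => (h.bandRight_le_one k).trans_eq (bandRight_last α).symm)
    (by rwa [bandRight_last])
  rw [bandRight_last, nodal_erase_bandRight, ← eval_mul, nodal_mul_nodal] at hband
  rw [chebyshevMeasure, lintegral_withDensity_eq_lintegral_mul _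
    (measurable_weight α β).ennreal_ofReal (by fun_prop)]
  calc ∫⁻ x in E α β, ENNReal.ofReal (weight α β x) * ENNReal.ofReal (1 / (z - x))
    _ = ∫⁻ x in E α β, ENNReal.ofReal (1 / Real.pi) *
          ENNReal.ofReal (√(bandMap (bandLeft β) (bandRight α) x) / (1 - x) / (z - x)) := by
        refine setLIntegral_congr_fun (measurableSet_E α β) fun x hx => ?_
        rw [← ENNReal.ofReal_mul (weight_nonneg α β x), ← ENNReal.ofReal_mul (by positivity),
          weight_eq (h.E_subset hx).2, mul_one_div, mul_div_assoc]
    _ = ENNReal.ofReal (1 / Real.pi) * ENNReal.ofReal (Real.pi *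
          ((numer α).eval z / √((numer α * denom β).eval z))) := by
        rw [lintegral_const_mul' _ _ ENNReal.ofReal_ne_top, ← hband]
        rfl
    _ = _ := by
        rw [← ENNReal.ofReal_mul (by positivity), ← mul_assoc, one_div,
          inv_mul_cancel₀ Real.pi_ne_zero, one_mul]

lemma isFiniteMeasure (h : IsBranchPoints α β) : IsFiniteMeasure (chebyshevMeasure α β) := by
  refine ⟨?_⟩
  have hle : ∀ᵐ x ∂chebyshevMeasure α β,
      (1 : ENNReal) ≤ ENNReal.ofReal 3 * ENNReal.ofReal (1 / (2 - x)) := by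
    filter_upwards [h.ae_mem_Icc] with x hx
    rw [← ENNReal.ofReal_mul zero_le_three, ENNReal.one_le_ofReal, mul_one_div,
      one_le_div (by linarith [hx.2])]
    linarith [hx.1]
  calc chebyshevMeasure α β Set.univ = ∫⁻ _, 1 ∂chebyshevMeasure α β := lintegral_one.symm
    _ ≤ ∫⁻ x, ENNReal.ofReal 3 * ENNReal.ofReal (1 / (2 - x)) ∂chebyshevMeasure α β :=
        lintegral_mono_ae hle
    _ < ⊤ := by
        rw [lintegral_const_mul' _ _ ENNReal.ofReal_ne_top, h.lintegral_inv_sub one_lt_two]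
        exact ENNReal.mul_lt_top ENNReal.ofReal_lt_top ENNReal.ofReal_lt_top

lemma stieltjes_one_eq (h : IsBranchPoints α β) (hz : 1 < z) :
    stieltjes (chebyshevMeasure α β) 1 z =
      (numer α).eval z / √((numer α * denom β).eval z) := by
  have hnonneg : 0 ≤ᵐ[chebyshevMeasure α β] fun x => 1 / (z - x) := by
    filter_upwards [h.ae_mem_Icc] with x hx
    exact one_div_nonneg.mpr (by linarith [hx.2])
  simp only [stieltjes, eval_one]
  rw [integral_eq_lintegral_of_nonneg_ae hnonneg
    (Measurable.aestronglyMeasurable (by fun_prop)), h.lintegral_inv_sub hz,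
    ENNReal.toReal_ofReal (div_nonneg (h.eval_numer_pos hz).le (Real.sqrt_nonneg _))]

lemma sq_stieltjes_one_mul (h : IsBranchPoints α β) (hz : 1 < z) :
    stieltjes (chebyshevMeasure α β) 1 z ^ 2 * (denom β).eval z = (numer α).eval z := by
  have hA := h.eval_numer_pos hz
  have hB := h.eval_denom_pos hz
  rw [h.stieltjes_one_eq hz, eval_mul, div_pow, Real.sq_sqrt (by positivity)]
  field_simp

lemma moment_one [IsFiniteMeasure (chebyshevMeasure α β)] (h : IsBranchPoints α β) :
    moment h.ae_mem_Icc 1 = 1 := by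
  have hmonic : (X ^ 2 * numer α).Monic := (monic_X_pow 2).mul (monic_numer α)
  have hdeg : (X ^ 2 * numer α).degree = (denom β).degree := by
    rw [degree_eq_natDegree hmonic.ne_zero, degree_eq_natDegree (monic_denom β).ne_zero,
      natDegree_denom, (monic_X_pow 2).natDegree_mul (monic_numer α), natDegree_numer,
      natDegree_X_pow, add_comm]
  have hone : Tendsto (fun z => (z * stieltjes (chebyshevMeasure α β) 1 z) ^ 2) atTop (𝓝 1) := by
    have hdiv := div_tendsto_atTop_leadingCoeff_div_of_degree_eq _ _ hdeg
    rw [hmonic.leadingCoeff, (monic_denom β).leadingCoeff, div_one] at hdiv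
    refine hdiv.congr' ?_
    filter_upwards [eventually_gt_atTop 1] with z hz
    rw [eval_mul, eval_pow, eval_X, ← h.sq_stieltjes_one_mul hz, mul_pow, ← mul_assoc,
      mul_div_cancel_right₀ _ (h.eval_denom_pos hz).ne']
  have hsq := tendsto_nhds_unique ((tendsto_mul_stieltjes_one h.ae_mem_Icc).pow 2) hone
  refine (pow_eq_one_iff_of_nonneg (integral_nonneg fun x => ?_) two_ne_zero).mp hsq
  simp

end IsBranchPoints


instance (α β : Fin g → ℝ) : NullSingletonClass (chebyshevMeasure α β) where
  measure_singleton x := withDensity_absolutelyContinuous _ _ (measure_singleton x)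

namespace IsBranchPoints

lemma neZero [IsFiniteMeasure (chebyshevMeasure α β)] (h : IsBranchPoints α β) :
    NeZero (chebyshevMeasure α β) := by
  refine ⟨fun hzero => one_ne_zero (α := ℝ) ?_⟩
  rw [← h.moment_one]
  change ∫ x, _ ∂chebyshevMeasure α β = 0
  rw [hzero, integral_zero_measure]

lemma pairing_eq_moment [IsFiniteMeasure (chebyshevMeasure α β)] (h : IsBranchPoints α β)
    (p q : ℝ[X]) : pairing α β p q = moment h.ae_mem_Icc (p * q) := by
  change _ = ∫ x, (p * q).eval x ∂chebyshevMeasure α β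
  simp only [integral_chebyshevMeasure, eval_mul, pairing]

lemma moment_mul_self_pos [IsFiniteMeasure (chebyshevMeasure α β)] (h : IsBranchPoints α β)
    {p : ℝ[X]} (hp : p ≠ 0) : 0 < moment h.ae_mem_Icc (p * p) :=
  have := h.neZero
  GenChebyshev.moment_mul_self_pos h.ae_mem_Icc hp

end IsBranchPoints

lemma IsMonicOrthogonal.isOrthogonalSequence [IsFiniteMeasure (chebyshevMeasure α β)]
    {P : ℕ → ℝ[X]} (hP : IsMonicOrthogonal α β P) (h : IsBranchPoints α β) :
    IsOrthogonalSequence (moment h.ae_mem_Icc) P where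
  monic := hP.monic
  natDegree_eq := hP.natDegree_eq
  map_mul m n hmn := h.pairing_eq_moment (P m) (P n) ▸ hP.orthogonal m n hmn

end ChebyshevMeasure

section SecondKind

variable {P : ℕ → ℝ[X]} {a b : ℕ → ℝ} {f : ℝ → ℝ}

/-- The polynomials of the second kind: the solution of the recurrence with initial values
`0` and `1`. -/
def secondKind (a b : ℕ → ℝ) : ℕ → ℝ[X]
  | 0 => 0
  | 1 => 1
  | n + 2 => (X - C (b (n + 2))) * secondKind a b (n + 1) - C (a (n + 1)) * secondKind a b n

lemma secondKind_zero (a b : ℕ → ℝ) : secondKind a b 0 = 0 := rfl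

lemma secondKind_one (a b : ℕ → ℝ) : secondKind a b 1 = 1 := rfl

lemma secondKind_add_two (a b : ℕ → ℝ) (n : ℕ) : secondKind a b (n + 2) =
    (X - C (b (n + 2))) * secondKind a b (n + 1) - C (a (n + 1)) * secondKind a b n := rfl

lemma isRecurrence_secondKind_succ (a b : ℕ → ℝ) :
    IsRecurrence (fun n => secondKind a b (n + 1)) (fun n => a (n + 1)) fun n => b (n + 1) where
  zero := by
    rw [secondKind_add_two, secondKind_zero, secondKind_one]
    ring
  succ n := by
    rw [secondKind_add_two a b (n + 1)]
    ring

namespace IsRecurrence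

lemma add_two (hab : IsRecurrence P a b) (n : ℕ) :
    P (n + 2) = (X - C (b (n + 2))) * P (n + 1) - C (a (n + 1)) * P n := by
  linear_combination -hab.succ n

lemma one_eq (hab : IsRecurrence P a b) (h0 : P 0 = 1) : P 1 = X - C (b 1) := by
  have hzero := hab.zero
  rw [h0] at hzero
  linear_combination -hzero

lemma isMonicOfDegree (hab : IsRecurrence P a b) (h0 : P 0 = 1) (n : ℕ) :
    IsMonicOfDegree (P n) n := by
  induction n using Nat.twoStepInduction with
  | zero => rw [h0, isMonicOfDegree_zero_iff]
  | one => exact hab.one_eq h0 ▸ isMonicOfDegree_X_sub_one (b 1)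
  | more n ih ih' =>
    have hmul : IsMonicOfDegree ((X - C (b (n + 2))) * P (n + 1)) (n + 2) :=
      (show 1 + (n + 1) = n + 2 by ring) ▸ (isMonicOfDegree_X_sub_one _).mul ih'
    rw [hab.add_two]
    refine hmul.sub ((natDegree_C_mul_le _ _).trans_lt ?_)
    rw [ih.natDegree_eq]
    lia

lemma casoratian (hab : IsRecurrence P a b) (h0 : P 0 = 1) (n : ℕ) :
    P n * secondKind a b (n + 1) - P (n + 1) * secondKind a b n =
      C (∏ i ∈ Finset.range n, a (i + 1)) := by
  induction n with
  | zero =>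
    rw [secondKind_one, secondKind_zero, h0, Finset.prod_range_zero, C_1]
    ring
  | succ n ih =>
    rw [Finset.prod_range_succ, C_mul, ← ih, secondKind_add_two, hab.add_two]
    ring

end IsRecurrence

lemma isMonicOfDegree_secondKind_succ (a b : ℕ → ℝ) (n : ℕ) :
    IsMonicOfDegree (secondKind a b (n + 1)) n :=
  (isRecurrence_secondKind_succ a b).isMonicOfDegree (secondKind_one a b) n

/-- The solution `P n * f - secondKind n` of the recurrence, called the function of the second kind
when `f` is the Stieltjes transform of the orthogonality measure. -/
def secondKindFun (P : ℕ → ℝ[X]) (a b : ℕ → ℝ) (f : ℝ → ℝ) (n : ℕ) (z : ℝ) : ℝ :=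
  (P n).eval z * f z - (secondKind a b n).eval z

lemma IsRecurrence.secondKindFun_add_two (hab : IsRecurrence P a b) (n : ℕ) (z : ℝ) :
    secondKindFun P a b f (n + 2) z =
      (z - b (n + 2)) * secondKindFun P a b f (n + 1) z -
        a (n + 1) * secondKindFun P a b f n z := by
  simp only [secondKindFun, hab.add_two, secondKind_add_two, eval_sub, eval_mul, eval_X, eval_C]
  ring

/-- `f` is the Weyl function of the sequence `P`, that is, it behaves like the Stieltjes transform
of the orthogonality measure: `P n * f - secondKind n` vanishes at infinity to order greater
than `n`. -/
def IsWeylFunction (P : ℕ → ℝ[X]) (a b : ℕ → ℝ) (f : ℝ → ℝ) : Prop :=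
  ∀ m n, m ≤ n → Tendsto (fun z => z ^ m * secondKindFun P a b f n z) atTop (𝓝 0)

lemma IsWeylFunction.tendsto_secondKindFun (hf : IsWeylFunction P a b f) (n : ℕ) :
    Tendsto (secondKindFun P a b f n) atTop (𝓝 0) := by
  simpa only [pow_zero, one_mul] using hf 0 n n.zero_le

lemma IsWeylFunction.tendsto (hf : IsWeylFunction P a b f) (h0 : P 0 = 1) :
    Tendsto f atTop (𝓝 0) := by
  refine (hf.tendsto_secondKindFun 0).congr fun z => ?_
  rw [secondKindFun, h0, secondKind_zero, eval_one, eval_zero, one_mul, sub_zero]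

section Stieltjes

variable {μ : Measure ℝ} [IsFiniteMeasure μ] {R z : ℝ}

lemma stieltjes_eq_secondKindFun (hμ : ∀ᵐ x ∂μ, x ∈ Set.Icc (-R) R)
    (hP : IsOrthogonalSequence (moment hμ) P) (hab : IsRecurrence P a b)
    (hone : moment hμ 1 = 1) (hz : R < z) (n : ℕ) :
    stieltjes μ (P n) z = secondKindFun P a b (stieltjes μ 1) n z := by
  have hsucc (p : ℝ[X]) (c : ℝ) :
      stieltjes μ ((X - C c) * p) z = (z - c) * stieltjes μ p z - moment hμ p := by
    rw [sub_mul, sub_eq_add_neg, ← neg_mul, ← C_neg, stieltjes_add hμ _ _ hz,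
      stieltjes_X_mul hμ _ hz, stieltjes_C_mul]
    ring
  induction n using Nat.twoStepInduction with
  | zero => simp [secondKindFun, hP.apply_zero, secondKind_zero]
  | one =>
    rw [hab.one_eq hP.apply_zero, ← mul_one (X - C (b 1)), hsucc, hone, secondKindFun,
      hab.one_eq hP.apply_zero, secondKind_one, eval_sub, eval_X, eval_C, eval_one]
  | more n ih ih' =>
    have hmean : moment hμ (P (n + 1)) = 0 := by
      rw [← one_mul (P (n + 1))]
      refine hP.map_mul_eq_zero ?_
      rw [degree_one]
      exact_mod_cast n.succ_pos
    rw [hab.add_two, sub_eq_add_neg, ← neg_mul, ← C_neg, stieltjes_add hμ _ _ hz, hsucc,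
      stieltjes_C_mul, ih, ih', hmean, hab.secondKindFun_add_two]
    ring

lemma IsOrthogonalSequence.isWeylFunction (hμ : ∀ᵐ x ∂μ, x ∈ Set.Icc (-R) R)
    (hP : IsOrthogonalSequence (moment hμ) P) (hab : IsRecurrence P a b)
    (hone : moment hμ 1 = 1) : IsWeylFunction P a b (stieltjes μ 1) := by
  refine fun m n hmn => (hP.tendsto_pow_mul_stieltjes hμ hmn).congr' ?_
  filter_upwards [eventually_gt_atTop R] with z hz
  rw [stieltjes_eq_secondKindFun hμ hP hab hone hz]

end Stieltjes

end SecondKind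

section Period

variable {P : ℕ → ℝ[X]} {a b : ℕ → ℝ} {f : ℝ → ℝ} {A B S p q : ℝ[X]} {K : ℕ} {c : ℝ}

lemma HasPeriod.casoratian_shift (hK : HasPeriod a b K) {u : ℕ → ℝ} {z : ℝ}
    (hu : ∀ n, u (n + 2) = (z - b (n + 2)) * u (n + 1) - a (n + 1) * u n) (n : ℕ) :
    u (n + 2 + K) * u (n + 1) - u (n + 1 + K) * u (n + 2) =
      (∏ i ∈ Finset.range n, a (i + 2)) * (a 1 * u 0 * u (K + 1) - a (K + 1) * u K * u 1) := by
  induction n with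
  | zero =>
    have hb := hK.b_periodic 2 one_le_two
    have hK2 := hu K
    rw [add_comm K 2, hb] at hK2
    rw [Finset.prod_range_zero, zero_add, zero_add, add_comm 1 K, hK2, hu 0]
    ring
  | succ n ih =>
    have hb := hK.b_periodic (n + 3) (by lia)
    have ha := hK.a_periodic (n + 2) (by lia)
    have hnK := hu (n + 1 + K)
    rw [show n + 1 + K + 2 = n + 3 + K by ring, hb, show n + 1 + K + 1 = n + 2 + K by ring,
      ha] at hnK
    rw [Finset.prod_range_succ, mul_right_comm, ← ih, show n + 1 + 2 + K = n + 3 + K by ring, hnK,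
      hu (n + 1)]
    ring_nf

lemma IsWeylFunction.superpolynomialDecay_casoratian (hf : IsWeylFunction P a b f)
    (hab : IsRecurrence P a b) (ha : ∀ n, a (n + 1) ≠ 0) (hK : HasPeriod a b K) :
    SuperpolynomialDecay atTop id fun z =>
      a 1 * secondKindFun P a b f 0 z * secondKindFun P a b f (K + 1) z -
        a (K + 1) * secondKindFun P a b f K z * secondKindFun P a b f 1 z := by
  intro n
  have hlim := (((hf n (n + 2 + K) (by lia)).mul (hf.tendsto_secondKindFun (n + 1))).sub
    ((hf n (n + 1 + K) (by lia)).mul (hf.tendsto_secondKindFun (n + 2)))).const_mul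
      (∏ i ∈ Finset.range n, a (i + 2))⁻¹
  rw [mul_zero, sub_zero, mul_zero] at hlim
  refine hlim.congr fun z => ?_
  rw [mul_assoc, mul_assoc, ← mul_sub,
    hK.casoratian_shift (u := fun n => secondKindFun P a b f n z)
      fun n => hab.secondKindFun_add_two n z, mul_left_comm,
    inv_mul_cancel_left₀ (Finset.prod_ne_zero_iff.mpr fun i _ => ha (i + 1)), id]

lemma eq_zero_of_sq_mul_eq (hA : ¬A.IsRoot c) (hB : Odd (B.rootMultiplicity c))
    (hpq : p ^ 2 * B = q ^ 2 * A) : p = 0 ∧ q = 0 := by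
  have hA0 : A ≠ 0 := fun h => hA (h ▸ eval_zero)
  have hB0 : B ≠ 0 := by
    rintro rfl
    simp at hB
  have hp : p = 0 := by
    by_contra hp
    have hq : q ≠ 0 := by
      rintro rfl
      exact mul_ne_zero (pow_ne_zero 2 hp) hB0 (hpq.trans (by ring))
    have hmult := congrArg (rootMultiplicity c) hpq
    rw [rootMultiplicity_mul (mul_ne_zero (pow_ne_zero 2 hp) hB0),
      rootMultiplicity_mul (mul_ne_zero (pow_ne_zero 2 hq) hA0), sq, sq,
      rootMultiplicity_mul (mul_ne_zero hp hp), rootMultiplicity_mul (mul_ne_zero hq hq),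
      rootMultiplicity_eq_zero hA] at hmult
    obtain ⟨k, hk⟩ := hB
    lia
  refine ⟨hp, ?_⟩
  rw [hp, zero_pow two_ne_zero, zero_mul] at hpq
  exact pow_eq_zero_iff two_ne_zero |>.mp ((mul_eq_zero.mp hpq.symm).resolve_right hA0)

lemma eq_zero_of_superpolynomialDecay (hA : ¬A.IsRoot c) (hB : Odd (B.rootMultiplicity c))
    (hf : Tendsto f atTop (𝓝 0)) (hsq : ∀ᶠ z in atTop, f z ^ 2 * B.eval z = A.eval z)
    (hpq : SuperpolynomialDecay atTop id fun z => p.eval z + q.eval z * f z) :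
    p = 0 ∧ q = 0 := by
  have hdecay (r : ℝ[X]) :
      Tendsto (fun z => r.eval z * (p.eval z + q.eval z * f z)) atTop (𝓝 0) := by
    simpa only [id, pow_zero, one_mul] using hpq.polynomial_mul r 0
  have hlim := (hdecay (B * p)).sub ((hdecay (B * q)).mul hf)
  rw [mul_zero, sub_zero] at hlim
  have hzero : Tendsto (fun z => (p ^ 2 * B - q ^ 2 * A).eval z) atTop (𝓝 0) := by
    refine hlim.congr' ?_
    filter_upwards [hsq] with z hz
    simp only [eval_sub, eval_mul, eval_pow]
    linear_combination -(q.eval z ^ 2) * hz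
  exact eq_zero_of_sq_mul_eq hA hB
    (sub_eq_zero.mp (leadingCoeff_eq_zero.mp ((Polynomial.tendsto_nhds_iff _).mp hzero).1))

lemma IsWeylFunction.period_relations (hf : IsWeylFunction P a b f) (hab : IsRecurrence P a b)
    (h0 : P 0 = 1) (ha : ∀ n, a (n + 1) ≠ 0) (hK : HasPeriod a b K)
    (hsq : ∀ᶠ z in atTop, f z ^ 2 * B.eval z = A.eval z) (hA : ¬A.IsRoot c)
    (hB : Odd (B.rootMultiplicity c)) :
    C (a (K + 1)) * (B * secondKind a b K) =
        A * (C (a 1) * P (K + 1) - C (a (K + 1)) * (P 1 * P K)) ∧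
      C (a 1) * secondKind a b (K + 1) = C (a (K + 1)) * (P K + P 1 * secondKind a b K) := by
  have hB0 : B ≠ 0 := by
    rintro rfl
    simp at hB
  have hdecay : SuperpolynomialDecay atTop id fun z =>
      (A * (C (a 1) * P (K + 1) - C (a (K + 1)) * (P 1 * P K)) -
        C (a (K + 1)) * (B * secondKind a b K)).eval z +
      (B * (C (a (K + 1)) * (P K + P 1 * secondKind a b K) -
        C (a 1) * secondKind a b (K + 1))).eval z * f z := by
    refine ((hf.superpolynomialDecay_casoratian hab ha hK).polynomial_mul B).congr' ?_
    filter_upwards [hsq] with z hz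
    simp only [secondKindFun, h0, secondKind_zero, secondKind_one, eval_sub, eval_mul, eval_add,
      eval_C, eval_one, eval_zero, id]
    linear_combination (a 1 * (P (K + 1)).eval z -
      a (K + 1) * (P 1).eval z * (P K).eval z) * hz
  obtain ⟨hconst, hlin⟩ := eq_zero_of_superpolynomialDecay hA hB (hf.tendsto h0) hsq hdecay
  exact ⟨(sub_eq_zero.mp hconst).symm,
    (sub_eq_zero.mp ((mul_eq_zero.mp hlin).resolve_left hB0)).symm⟩

/-- The effect of a period `K` on the polynomials of the first and the second kind: the shift by `K`
acts on the solutions of the recurrence with the Floquet multipliers `(P K ± √(A * B) * S) / 2`. -/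
structure IsPeriodCofactor (P : ℕ → ℝ[X]) (a b : ℕ → ℝ) (K : ℕ) (A B S : ℝ[X]) : Prop where
  coeff_one : a 1 = 2 * a (K + 1)
  secondKind_eq : secondKind a b K = A * S
  two_mul_succ : 2 * P (K + 1) = P K * P 1 + B * S
  two_mul_secondKind_succ : 2 * secondKind a b (K + 1) = P K + secondKind a b K * P 1

lemma coeff_one_eq (hab : IsRecurrence P a b) (h0 : P 0 = 1) (hK : 0 < K)
    (h : C (a 1) * secondKind a b (K + 1) = C (a (K + 1)) * (P K + P 1 * secondKind a b K)) :
    a 1 = 2 * a (K + 1) := by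
  have hmul : IsMonicOfDegree (P 1 * secondKind a b K) K := by
    obtain ⟨k, rfl⟩ := Nat.exists_eq_succ_of_ne_zero hK.ne'
    rw [Nat.succ_eq_add_one, add_comm k 1]
    exact (hab.isMonicOfDegree h0 1).mul (add_comm 1 k ▸ isMonicOfDegree_secondKind_succ a b k)
  have hone {p : ℝ[X]} (hp : IsMonicOfDegree p K) : p.coeff K = 1 :=
    ((isMonicOfDegree_iff p K).mp hp).2
  have hcoeff := congrArg (coeff · K) h
  simp only [coeff_C_mul, coeff_add, hone (isMonicOfDegree_secondKind_succ a b K),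
    hone (hab.isMonicOfDegree h0 K), hone hmul] at hcoeff
  linarith

lemma IsWeylFunction.exists_isPeriodCofactor (hf : IsWeylFunction P a b f)
    (hab : IsRecurrence P a b) (h0 : P 0 = 1) (ha : ∀ n, a (n + 1) ≠ 0) (hK : HasPeriod a b K)
    (hsq : ∀ᶠ z in atTop, f z ^ 2 * B.eval z = A.eval z) (hA : ¬A.IsRoot c)
    (hB : Odd (B.rootMultiplicity c)) (hAB : IsCoprime A B) :
    ∃ S, IsPeriodCofactor P a b K A B S := by
  obtain ⟨hrel, hrel'⟩ := hf.period_relations hab h0 ha hK hsq hA hB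
  have hone := coeff_one_eq hab h0 hK.pos hrel'
  have hC : (C (a (K + 1)) : ℝ[X]) ≠ 0 := C_ne_zero.mpr (ha K)
  have htwo : (C (a 1) : ℝ[X]) = 2 * C (a (K + 1)) := by
    rw [hone, C_mul, C_ofNat]
  rw [htwo] at hrel hrel'
  have hdvd : B * secondKind a b K = A * (2 * P (K + 1) - P 1 * P K) :=
    mul_left_cancel₀ hC (by linear_combination hrel)
  obtain ⟨S, hS⟩ : A ∣ secondKind a b K := hAB.dvd_of_dvd_mul_left (Dvd.intro _ hdvd.symm)
  have hA0 : A ≠ 0 := fun h => hA (h ▸ eval_zero)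
  have hBS : B * S = 2 * P (K + 1) - P 1 * P K :=
    mul_left_cancel₀ hA0 (by rw [← hdvd, hS]; ring)
  exact ⟨S, hone, hS, by linear_combination -hBS,
    mul_left_cancel₀ hC (by linear_combination hrel')⟩

namespace IsPeriodCofactor

lemma pell (hS : IsPeriodCofactor P a b K A B S) (hab : IsRecurrence P a b) (h0 : P 0 = 1) :
    P K ^ 2 - A * B * S ^ 2 = C (2 * ∏ i ∈ Finset.range K, a (i + 1)) := by
  rw [C_mul, ← hab.casoratian h0 K, C_ofNat]
  linear_combination (-P K) * hS.two_mul_secondKind_succ +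
    secondKind a b K * hS.two_mul_succ + B * S * hS.secondKind_eq

lemma add_period (hS : IsPeriodCofactor P a b K A B S) (hab : IsRecurrence P a b) (h0 : P 0 = 1)
    (hK : HasPeriod a b K) (n : ℕ) :
    2 * P (n + 1 + K) = P K * P (n + 1) + B * S * secondKind a b (n + 1) ∧
      2 * secondKind a b (n + 1 + K) =
        P K * secondKind a b (n + 1) + secondKind a b K * P (n + 1) := by
  induction n using Nat.twoStepInduction with
  | zero =>
    rw [zero_add, add_comm 1 K, secondKind_one, mul_one, mul_one]
    exact ⟨hS.two_mul_succ, hS.two_mul_secondKind_succ⟩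
  | one =>
    have ha : (C (a 1) : ℝ[X]) = 2 * C (a (K + 1)) := by
      rw [hS.coeff_one, C_mul, C_ofNat]
    have hP := hab.add_two K
    have hQ := secondKind_add_two a b K
    have hP2 := hab.add_two 0
    have hQ2 := secondKind_add_two a b 0
    rw [add_comm K 2, hK.b_periodic 2 one_le_two] at hP hQ
    simp only [zero_add, h0, secondKind_zero, secondKind_one] at hP2 hQ2
    rw [show 1 + 1 = 2 from rfl, hP, hQ, hP2, hQ2]
    constructor
    · linear_combination (X - C (b 2)) * hS.two_mul_succ + P K * ha
    · linear_combination (X - C (b 2)) * hS.two_mul_secondKind_succ + secondKind a b K * ha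
  | more n ih ih' =>
    have hP := hab.add_two (n + 1 + K)
    have hQ := secondKind_add_two a b (n + 1 + K)
    rw [show n + 1 + K + 2 = n + 1 + 2 + K by ring, show n + 1 + K + 1 = n + 1 + 1 + K by ring,
      hK.b_periodic (n + 1 + 2) (by lia), hK.a_periodic (n + 1 + 1) (by lia)] at hP hQ
    rw [show n + 2 + 1 + K = n + 1 + 2 + K by ring, show n + 2 + 1 = n + 1 + 2 by ring, hP, hQ,
      hab.add_two (n + 1), secondKind_add_two a b (n + 1)]
    constructor
    · linear_combination (X - C (b (n + 1 + 2))) * ih'.1 - C (a (n + 1 + 1)) * ih.1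
    · linear_combination (X - C (b (n + 1 + 2))) * ih'.2 - C (a (n + 1 + 1)) * ih.2

end IsPeriodCofactor

end Period

section Image

variable {f : ℝ → ℝ} {l r : ℝ}

lemma exists_eq_neg_one_of_deriv (hlr : l ≤ r) (hf : ContinuousOn f (Set.Icc l r))
    (hl : f l ^ 2 = 1) (hr : f r ^ 2 = 1) (hle : ∀ x ∈ Set.Icc l r, f x ^ 2 ≤ 1)
    (hcrit : ∀ x, deriv f x = 0 → 1 ≤ f x ^ 2) (hne : ∃ x ∈ Set.Icc l r, f x ^ 2 ≠ 1) :
    ∃ x ∈ Set.Icc l r, f x = -1 := by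
  by_contra! hcon
  have hone {x : ℝ} (hx : x ∈ Set.Icc l r) (hsq : f x ^ 2 = 1) : f x = 1 :=
    (sq_eq_one_iff.mp hsq).resolve_right (hcon x hx)
  obtain ⟨x, hx, hmin⟩ := isCompact_Icc.exists_isMinOn (Set.nonempty_Icc.mpr hlr) hf
  have hx1 : f x ≠ 1 := by
    obtain ⟨y, hy, hy1⟩ := hne
    have hylt : f y < 1 := by
      refine lt_of_le_of_ne ?_ fun h => hy1 (by rw [h, one_pow])
      exact (abs_le.mp ((sq_le_one_iff_abs_le_one _).mp (hle y hy))).2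
    exact ((hmin hy).trans_lt hylt).ne
  have hxl : x ≠ l := fun h => hx1 (h ▸ hone (Set.left_mem_Icc.mpr hlr) hl)
  have hxr : x ≠ r := fun h => hx1 (h ▸ hone (Set.right_mem_Icc.mpr hlr) hr)
  have hloc : IsLocalMin f x :=
    hmin.isLocalMin (Icc_mem_nhds (hx.1.lt_of_ne hxl.symm) (hx.2.lt_of_ne hxr))
  exact hx1 (hone hx ((hle x hx).antisymm (hcrit x hloc.deriv_eq_zero)))

lemma image_Icc_eq_of_deriv (hlr : l ≤ r) (hf : ContinuousOn f (Set.Icc l r))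
    (hl : f l ^ 2 = 1) (hr : f r ^ 2 = 1) (hle : ∀ x ∈ Set.Icc l r, f x ^ 2 ≤ 1)
    (hcrit : ∀ x, deriv f x = 0 → 1 ≤ f x ^ 2) (hne : ∃ x ∈ Set.Icc l r, f x ^ 2 ≠ 1) :
    f '' Set.Icc l r = Set.Icc (-1) 1 := by
  refine Set.Subset.antisymm (Set.image_subset_iff.mpr fun x hx => ?_) ?_
  · exact abs_le.mp ((sq_le_one_iff_abs_le_one _).mp (hle x hx))
  · obtain ⟨x, hx, hfx⟩ := exists_eq_neg_one_of_deriv hlr hf hl hr hle hcrit hne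
    obtain ⟨y, hy, hfy⟩ := exists_eq_neg_one_of_deriv (f := fun x => -f x) hlr hf.neg
      (by rwa [neg_sq]) (by rwa [neg_sq]) (by simpa only [neg_sq] using hle)
      (fun x hx => (neg_sq (f x)).symm ▸ hcrit x (neg_eq_zero.mp (deriv.fun_neg.symm.trans hx)))
      (by simpa only [neg_sq] using hne)
    exact (isPreconnected_Icc.image f hf).Icc_subset ⟨x, hx, hfx⟩ ⟨y, hy, neg_inj.mp hfy⟩

end Image

section Herglotz

open ComplexConjugate

variable {P : ℕ → ℝ[X]} {a b : ℕ → ℝ} {A B S p u v : ℝ[X]} {K : ℕ} {x : ℝ} {z : ℂ}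

/-- The rational function `u / v` has derivative at least `1` on the real line and satisfies
`im z ≤ im (u z / v z)` on the upper half-plane; both conditions are multiplied by `|v| ^ 2`, so
that they make sense at the zeros of `v`. -/
structure IsHerglotzRatio (u v : ℝ[X]) : Prop where
  sq_le_wronskian : ∀ x, v.eval x ^ 2 ≤ (wronskian v u).eval x
  im_le : ∀ z : ℂ, 0 < z.im → z.im * Complex.normSq (aeval z v) ≤ (aeval z u * conj (aeval z v)).im

lemma eval_wronskian (v u : ℝ[X]) (x : ℝ) : (wronskian v u).eval x =
    v.eval x * u.derivative.eval x - v.derivative.eval x * u.eval x := by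
  simp only [wronskian, eval_sub, eval_mul]

lemma isHerglotzRatio_X_sub_C_one (β : ℝ) : IsHerglotzRatio (X - C β) 1 where
  sq_le_wronskian x := by simp [eval_wronskian]
  im_le z _ := by simp

lemma isHerglotzRatio_one_zero : IsHerglotzRatio 1 0 where
  sq_le_wronskian x := by simp
  im_le z _ := by simp

lemma IsHerglotzRatio.step (h : IsHerglotzRatio v u) (β : ℝ) {γ : ℝ} (hγ : 0 ≤ γ) :
    IsHerglotzRatio ((X - C β) * v - C γ * u) v where
  sq_le_wronskian x := by
    have hw := mul_nonneg hγ ((sq_nonneg (u.eval x)).trans (h.sq_le_wronskian x))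
    rw [eval_wronskian] at hw ⊢
    simp only [derivative_sub, derivative_mul, derivative_X, derivative_C, eval_sub, eval_add,
      eval_mul, eval_X, eval_C, eval_one, eval_zero]
    linarith
  im_le z hz := by
    have hw := mul_nonneg hγ ((mul_nonneg hz.le (Complex.normSq_nonneg _)).trans (h.im_le z hz))
    simp only [map_sub, map_mul, aeval_X, aeval_C, Complex.coe_algebraMap, Complex.mul_im,
      Complex.sub_re, Complex.sub_im, Complex.mul_re, Complex.ofReal_re, Complex.ofReal_im,
      Complex.conj_re, Complex.conj_im, Complex.normSq_apply] at hw ⊢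
    linarith

lemma isHerglotzRatio_of_recurrence {Y : ℕ → ℝ[X]}
    (hY : ∀ n, Y (n + 2) = (X - C (b (n + 2))) * Y (n + 1) - C (a (n + 1)) * Y n)
    (ha : ∀ n, 0 < a (n + 1)) (h : IsHerglotzRatio (Y 1) (Y 0)) (n : ℕ) :
    IsHerglotzRatio (Y (n + 1)) (Y n) := by
  induction n with
  | zero => exact h
  | succ n ih => exact hY n ▸ ih.step (b (n + 2)) (ha n).le

lemma IsHerglotzRatio.C_mul (h : IsHerglotzRatio u v) (r : ℝ) :
    IsHerglotzRatio (C r * u) (C r * v) where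
  sq_le_wronskian x := by
    have hw := mul_le_mul_of_nonneg_left (h.sq_le_wronskian x) (sq_nonneg r)
    simp only [eval_wronskian, derivative_C_mul, eval_mul, eval_C] at hw ⊢
    linarith
  im_le z hz := by
    have hw := mul_le_mul_of_nonneg_left (h.im_le z hz) (sq_nonneg r)
    simp only [map_mul, aeval_C, Complex.coe_algebraMap, Complex.normSq_ofReal,
      Complex.conj_ofReal] at hw ⊢
    rw [mul_mul_mul_comm, ← Complex.ofReal_mul, Complex.im_ofReal_mul]
    linarith

/-- A solution of Pell's equation for `A * B` such that `p / (A * S)` and `(B * S) / p`, two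
approximations of `√(B / A)`, are Herglotz functions. -/
structure IsHerglotzPell (A B p S : ℝ[X]) : Prop where
  pell : p ^ 2 - A * B * S ^ 2 = 1
  div : IsHerglotzRatio p (A * S)
  div' : IsHerglotzRatio (B * S) p

namespace IsPeriodCofactor

lemma isHerglotzRatio_div (hS : IsPeriodCofactor P a b K A B S)
    (hab : IsRecurrence P a b) (h0 : P 0 = 1) (ha : ∀ n, 0 < a (n + 1)) (hK : HasPeriod a b K) :
    IsHerglotzRatio (P K) (A * S) := by
  obtain ⟨k, rfl⟩ := Nat.exists_eq_succ_of_ne_zero hK.pos.ne'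
  have hP : P (k + 1) =
      (X - C (b 1)) * secondKind a b (k + 1) - C (2 * a (k + 1)) * secondKind a b k := by
    have hQ := secondKind_add_two a b k
    rw [add_comm k 2, show 2 + k = 1 + (k + 1) by ring, hK.b_periodic 1 le_rfl] at hQ
    rw [C_mul, C_ofNat, ← hab.one_eq h0]
    have hS' := hS.two_mul_secondKind_succ
    rw [hab.one_eq h0] at hS' ⊢
    rw [Nat.succ_eq_add_one, add_comm (k + 1) 1, hQ] at hS'
    linear_combination -hS'
  rw [← hS.secondKind_eq, Nat.succ_eq_add_one, hP]
  exact (isHerglotzRatio_of_recurrence (secondKind_add_two a b) ha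
    isHerglotzRatio_one_zero k).step (b 1) (mul_pos two_pos (ha k)).le

lemma isHerglotzRatio_div' (hS : IsPeriodCofactor P a b K A B S)
    (hab : IsRecurrence P a b) (h0 : P 0 = 1) (ha : ∀ n, 0 < a (n + 1)) (hK : HasPeriod a b K) :
    IsHerglotzRatio (B * S) (P K) := by
  obtain ⟨k, rfl⟩ := Nat.exists_eq_succ_of_ne_zero hK.pos.ne'
  have hBS : B * S = (X - C (b 1)) * P (k + 1) - C (2 * a (k + 1)) * P k := by
    have hP := hab.add_two k
    rw [add_comm k 2, show 2 + k = 1 + (k + 1) by ring, hK.b_periodic 1 le_rfl] at hP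
    have hS' := hS.two_mul_succ
    rw [hab.one_eq h0, Nat.succ_eq_add_one, add_comm (k + 1) 1, hP] at hS'
    rw [C_mul, C_ofNat]
    linear_combination -hS'
  have hbase : IsHerglotzRatio (P 1) (P 0) := by
    rw [hab.one_eq h0, h0]
    exact isHerglotzRatio_X_sub_C_one (b 1)
  rw [hBS]
  exact (isHerglotzRatio_of_recurrence hab.add_two ha hbase k).step (b 1)
    (mul_pos two_pos (ha k)).le

lemma isHerglotzPell (hS : IsPeriodCofactor P a b K A B S) (hab : IsRecurrence P a b)
    (h0 : P 0 = 1) (ha : ∀ n, 0 < a (n + 1)) (hK : HasPeriod a b K) {d : ℝ} (hd : d ≠ 0)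
    (hsq : d ^ 2 = 2 * ∏ i ∈ Finset.range K, a (i + 1)) :
    IsHerglotzPell A B (C d⁻¹ * P K) (C d⁻¹ * S) where
  pell := by
    have hpell := congrArg (C (d⁻¹ ^ 2) * ·) (hS.pell hab h0)
    simp only [← hsq, ← C_mul, ← mul_pow, inv_mul_cancel₀ hd, one_pow, C_1] at hpell
    rw [← hpell, C_pow]
    ring
  div := by
    rw [mul_left_comm]
    exact (hS.isHerglotzRatio_div hab h0 ha hK).C_mul d⁻¹
  div' := by
    rw [mul_left_comm]
    exact (hS.isHerglotzRatio_div' hab h0 ha hK).C_mul d⁻¹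

end IsPeriodCofactor

namespace IsHerglotzPell

lemma eval_pell (h : IsHerglotzPell A B p S) (x : ℝ) :
    p.eval x ^ 2 = 1 + (A * B).eval x * S.eval x ^ 2 := by
  have hx := congrArg (fun r : ℝ[X] => r.eval x) h.pell
  simp only [eval_sub, eval_pow, eval_mul, eval_one] at hx ⊢
  linarith

lemma eval_nonpos_of_isRoot (h : IsHerglotzPell A B p S) (hx : S.eval x = 0) :
    (A * B).eval x ≤ 0 := by
  have hpell := h.eval_pell x
  have hdiv := h.div.sq_le_wronskian x
  have hdiv' := h.div'.sq_le_wronskian x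
  simp only [eval_wronskian, derivative_mul, eval_mul, eval_add, hx] at hpell hdiv hdiv'
  set t := p.eval x * S.derivative.eval x
  have hB : 1 ≤ B.eval x * t := by linarith
  have hA : A.eval x * t ≤ 0 := by linarith
  have ht : 0 < t ^ 2 := by
    refine sq_pos_of_ne_zero fun ht => ?_
    rw [ht, mul_zero] at hB
    exact one_pos.not_ge hB
  have hprod := mul_nonpos_of_nonpos_of_nonneg hA (zero_le_one.trans hB)
  rw [eval_mul]
  exact nonpos_of_mul_nonpos_left (by linarith) ht

lemma sq_le_iff (h : IsHerglotzPell A B p S) : p.eval x ^ 2 ≤ 1 ↔ (A * B).eval x ≤ 0 := by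
  rw [h.eval_pell, add_le_iff_nonpos_right]
  refine ⟨fun hle => ?_, fun hle => mul_nonpos_of_nonpos_of_nonneg hle (sq_nonneg _)⟩
  by_contra! hpos
  refine hpos.not_ge (h.eval_nonpos_of_isRoot (pow_eq_zero_iff two_ne_zero |>.mp ?_))
  exact le_antisymm (nonpos_of_mul_nonpos_right hle hpos) (sq_nonneg _)

lemma le_sq_of_derivative_eq_zero (h : IsHerglotzPell A B p S)
    (hx : p.derivative.eval x = 0) : 1 ≤ p.eval x ^ 2 := by
  by_contra! hlt
  have hdiv := h.div.sq_le_wronskian x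
  have hdiv' := h.div'.sq_le_wronskian x
  have hderiv := congrArg (fun r : ℝ[X] => r.derivative.eval x)
    (show p ^ 2 - (B * S) * (A * S) = 1 by rw [← h.pell]; ring)
  have hneg : (B * S).eval x * (A * S).eval x < 0 := by
    have hpell := h.eval_pell x
    simp only [eval_mul] at hpell ⊢
    linarith
  simp only [derivative_sub, derivative_pow, derivative_mul (f := B * S), derivative_one, eval_sub,
    eval_add, eval_mul (p := derivative _), eval_mul (q := derivative _), eval_zero, hx,
    eval_wronskian] at hderiv hdiv hdiv'
  generalize (B * S).eval x = G, (A * S).eval x = q, (B * S).derivative.eval x = G',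
    (A * S).derivative.eval x = q' at *
  have hq : 0 < q ^ 2 := by
    have := right_ne_zero_of_mul hneg.ne
    positivity
  have hG : 0 ≤ p.eval x * G' := by linarith [sq_nonneg (p.eval x)]
  have hq' : 0 < -(q' * p.eval x) := by linarith
  have hprod : p.eval x * G' * q ^ 2 = G * q * -(q' * p.eval x) := by
    linear_combination (-(p.eval x) * q) * hderiv
  exact (mul_neg_of_neg_of_pos hneg hq').not_ge (hprod ▸ mul_nonneg hG hq.le)

lemma lt_sq_of_im_pos (h : IsHerglotzPell A B p S) (hA : aeval z A ≠ 0) (hz : 0 < z.im)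
    {r : ℝ} (hr : aeval z p = r) : 1 < r ^ 2 := by
  by_contra! hrc
  have hdiv := h.div.im_le z hz
  have hdiv' := h.div'.im_le z hz
  have hpell := congrArg (aeval z) (show p ^ 2 - (B * S) * (A * S) = 1 by rw [← h.pell]; ring)
  rw [map_sub, map_pow, map_mul, map_one, hr] at hpell
  rw [hr, Complex.normSq_ofReal, Complex.conj_ofReal, Complex.im_mul_ofReal] at hdiv'
  rw [hr, Complex.im_ofReal_mul, Complex.conj_im] at hdiv
  have hzero (hw : aeval z (B * S) ≠ 0) : aeval z (A * S) ≠ 0 := by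
    rw [map_mul] at hw ⊢
    exact mul_ne_zero hA (right_ne_zero_of_mul hw)
  generalize aeval z (B * S) = w, aeval z (A * S) = s at *
  have hw : r ≠ 0 → 0 < r * w.im := fun hr0 =>
    (mul_pos hz (mul_self_pos.mpr hr0)).trans_le (by linarith)
  have hw0 : r ≠ 0 → w ≠ 0 := fun hr0 h0 => by simpa [h0] using hw hr0
  have hs : s ≠ 0 := fun hs => by
    have hr0 : r ≠ 0 := by
      rintro rfl
      rw [hs, Complex.ofReal_zero, mul_zero, sub_zero, zero_pow two_ne_zero] at hpell
      exact zero_ne_one hpell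
    exact hzero (hw0 hr0) hs
  have hneg : r * s.im < 0 := by linarith [mul_pos hz (Complex.normSq_pos.mpr hs)]
  have hr0 : r ≠ 0 := left_ne_zero_of_mul hneg.ne
  have hprod : r * s.im * Complex.normSq w = (1 - r ^ 2) * (r * w.im) := by
    have hre := congrArg Complex.re hpell
    have him := congrArg Complex.im hpell
    simp only [← Complex.ofReal_pow, Complex.sub_re, Complex.sub_im, Complex.mul_re,
      Complex.mul_im, Complex.ofReal_re, Complex.ofReal_im, Complex.one_re,
      Complex.one_im] at hre him
    rw [Complex.normSq_apply]
    linear_combination (-r * w.re) * him + (r * w.im) * hre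
  exact (mul_neg_of_neg_of_pos hneg (Complex.normSq_pos.mpr (hw0 hr0))).not_ge
    (hprod ▸ mul_nonneg (sub_nonneg.mpr hrc) (hw hr0).le)

lemma im_eq_zero (h : IsHerglotzPell A B p S) (hA : ∀ z : ℂ, 0 < z.im → aeval z A ≠ 0) {r : ℝ}
    (hr : aeval z p = r) (hrc : r ^ 2 ≤ 1) : z.im = 0 := by
  rcases lt_trichotomy z.im 0 with hz | hz | hz
  · have hz' : 0 < (conj z).im := by rwa [Complex.conj_im, neg_pos]
    have hr' : aeval (conj z) p = r := by rw [aeval_conj, hr, Complex.conj_ofReal]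
    exact absurd hrc (h.lt_sq_of_im_pos (hA _ hz') hz' hr').not_ge
  · exact hz
  · exact absurd hrc (h.lt_sq_of_im_pos (hA z hz) hz hr).not_ge

lemma image_Icc_eq (h : IsHerglotzPell A B p S) {l r : ℝ} (hlr : l < r) (hl : (A * B).eval l = 0)
    (hr : (A * B).eval r = 0) (hle : ∀ x ∈ Set.Icc l r, (A * B).eval x ≤ 0)
    (hp : p.natDegree ≠ 0) : (fun x => p.eval x) '' Set.Icc l r = Set.Icc (-1) 1 := by
  refine image_Icc_eq_of_deriv hlr.le p.continuous.continuousOn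
    (by rw [h.eval_pell, hl, zero_mul, add_zero]) (by rw [h.eval_pell, hr, zero_mul, add_zero])
    (fun x hx => h.sq_le_iff.mpr (hle x hx))
    (fun x hx => h.le_sq_of_derivative_eq_zero (p.deriv ▸ hx)) ?_
  by_contra! hcon
  have hsq : p ^ 2 = 1 := by
    refine eq_of_infinite_eval_eq _ _ ((Set.Icc_infinite hlr).mono fun x hx => ?_)
    rw [Set.mem_ofPred_eq, eval_pow, eval_one, hcon x hx]
  have hdeg := congrArg natDegree hsq
  rw [natDegree_pow, natDegree_one] at hdeg
  lia

lemma mem_Icc_iff (h : IsHerglotzPell A B p S) :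
    p.eval x ∈ Set.Icc (-1) 1 ↔ (A * B).eval x ≤ 0 := by
  rw [← h.sq_le_iff, Set.mem_Icc, ← abs_le, sq_le_one_iff_abs_le_one]

lemma preimage_aeval_eq (h : IsHerglotzPell A B p S) (hA : ∀ z : ℂ, 0 < z.im → aeval z A ≠ 0) :
    (fun z : ℂ => aeval z p) ⁻¹' ((fun t : ℝ => (t : ℂ)) '' Set.Icc (-1) 1) =
      (fun x : ℝ => (x : ℂ)) '' {x | (A * B).eval x ≤ 0} := by
  have haeval (x : ℝ) : aeval (x : ℂ) p = ((p.eval x : ℝ) : ℂ) :=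
    aeval_algebraMap_apply_eq_algebraMap_eval x p
  refine Set.Subset.antisymm ?_ (Set.image_subset_iff.mpr fun x hx =>
    ⟨p.eval x, h.mem_Icc_iff.mpr hx, (haeval x).symm⟩)
  rintro z ⟨t, ht, htz⟩
  have him := h.im_eq_zero hA htz.symm ((sq_le_one_iff_abs_le_one t).mpr (abs_le.mpr ht))
  obtain ⟨x, rfl⟩ : ∃ x : ℝ, (x : ℂ) = z := ⟨z.re, Complex.ext rfl him.symm⟩
  refine ⟨x, h.mem_Icc_iff.mp ?_, rfl⟩
  rwa [← Complex.ofReal_injective (htz.trans (haeval x))]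

end IsHerglotzPell

end Herglotz

section Chebyshev

variable {P : ℕ → ℝ[X]} {a b : ℕ → ℝ} {A B S : ℝ[X]} {K : ℕ} {d : ℝ}

lemma monicT_zero : monicT 0 = 1 := by
  rw [monicT, Nat.cast_zero, Chebyshev.T_zero, leadingCoeff_one, inv_one, C_1, one_mul]

lemma monicT_succ (n : ℕ) : monicT (n + 1) = C ((2 : ℝ) ^ n)⁻¹ * Chebyshev.T ℝ (n + 1) := by
  rw [monicT, Chebyshev.leadingCoeff_T, Int.natAbs_natCast, Nat.add_sub_cancel, Nat.cast_succ]

namespace IsPeriodCofactor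

lemma add_two_period (hS : IsPeriodCofactor P a b K A B S) (hab : IsRecurrence P a b)
    (h0 : P 0 = 1) (hK : HasPeriod a b K) (n : ℕ) :
    4 * P (n + 1 + K + K) = 4 * P K * P (n + 1 + K) -
      C (2 * ∏ i ∈ Finset.range K, a (i + 1)) * P (n + 1) := by
  obtain ⟨hP, hQ⟩ := hS.add_period hab h0 hK n
  have hPK := (hS.add_period hab h0 hK (n + K)).1
  rw [show n + K + 1 = n + 1 + K by ring] at hPK
  rw [← hS.pell hab h0]
  linear_combination 2 * hPK - P K * hP + B * S * hQ + B * S * P (n + 1) * hS.secondKind_eq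

lemma apply_mul_period (hS : IsPeriodCofactor P a b K A B S) (hab : IsRecurrence P a b)
    (h0 : P 0 = 1) (hK : HasPeriod a b K) (hd : d ≠ 0)
    (hsq : d ^ 2 = 2 * ∏ i ∈ Finset.range K, a (i + 1)) (n : ℕ) :
    C (2 ^ n) * P ((n + 1) * K) =
      C (d ^ (n + 1)) * (Chebyshev.T ℝ (n + 1)).comp (C d⁻¹ * P K) := by
  have hM : C d * (C d⁻¹ * P K) = P K := by
    rw [← mul_assoc, ← C_mul, mul_inv_cancel₀ hd, C_1, one_mul]
  simp only [C_pow, C_ofNat]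
  induction n using Nat.twoStepInduction with
  | zero => simp [hM]
  | one =>
    obtain ⟨k, hk⟩ := Nat.exists_eq_succ_of_ne_zero hK.pos.ne'
    have hPK := (hS.add_period hab h0 hK k).1
    have hpell := hS.pell hab h0
    rw [← Nat.succ_eq_add_one, ← hk, ← two_mul, hS.secondKind_eq] at hPK
    rw [← hsq, C_pow] at hpell
    rw [show (((1 : ℕ) : ℤ) + 1) = 2 by norm_num, Chebyshev.T_two]
    simp only [sub_comp, mul_comp, pow_comp, X_comp, one_comp, ofNat_comp]
    generalize C d⁻¹ * P K = M at *
    rw [← hM] at hpell hPK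
    linear_combination hPK - hpell
  | more n ih ih' =>
    obtain ⟨m, hm⟩ := Nat.exists_eq_succ_of_ne_zero (mul_pos n.succ_pos hK.pos).ne'
    have hPK := hS.add_two_period hab h0 hK m
    rw [← Nat.succ_eq_add_one, ← hm, ← hsq, C_pow, Nat.succ_eq_add_one,
      ← add_one_mul, ← add_one_mul] at hPK
    have hT : Chebyshev.T ℝ ((n + 2 : ℕ) + 1) =
        2 * X * Chebyshev.T ℝ ((n + 1 : ℕ) + 1) - Chebyshev.T ℝ (n + 1) :=
      mod_cast Chebyshev.T_add_two ℝ (n + 1)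
    rw [hT, sub_comp, mul_comp, mul_comp, X_comp, ofNat_comp]
    generalize C d⁻¹ * P K = M at *
    rw [← hM] at hPK
    linear_combination 2 ^ n * hPK + 2 * C d * M * ih' - C d ^ 2 * ih

lemma monicT_comp (hS : IsPeriodCofactor P a b K A B S) (hab : IsRecurrence P a b)
    (h0 : P 0 = 1) (hK : HasPeriod a b K) (hd : d ≠ 0)
    (hsq : d ^ 2 = 2 * ∏ i ∈ Finset.range K, a (i + 1)) (n : ℕ) :
    (monicT n).comp (C d⁻¹ * P K) = C (d ^ n)⁻¹ * P (n * K) := by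
  cases n with
  | zero => rw [monicT_zero, one_comp, zero_mul, h0, pow_zero, inv_one, C_1, one_mul]
  | succ n =>
    have htwo : (2 ^ n : ℝ) ≠ 0 := pow_ne_zero n two_ne_zero
    have hdn := pow_ne_zero (n + 1) hd
    have hC (r : ℝ) (q : ℝ[X]) : C (2 ^ n * d ^ (n + 1)) * (C r * q) =
        C (2 ^ n * d ^ (n + 1) * r) * q := by rw [← mul_assoc, ← C_mul]
    refine mul_left_cancel₀ (C_ne_zero.mpr (mul_ne_zero htwo hdn)) ?_
    rw [monicT_succ, mul_comp, C_comp, hC, hC, mul_inv_cancel_right₀ hdn, mul_right_comm,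
      mul_inv_cancel₀ htwo, one_mul, hS.apply_mul_period hab h0 hK hd hsq]

lemma natDegree_lt (hS : IsPeriodCofactor P a b K A B S) (hK : 0 < K) : A.natDegree < K := by
  obtain ⟨k, rfl⟩ := Nat.exists_eq_succ_of_ne_zero hK.ne'
  have hQ := isMonicOfDegree_secondKind_succ a b k
  rw [Nat.lt_succ_iff, ← hQ.natDegree_eq]
  exact natDegree_le_of_dvd (Dvd.intro S hS.secondKind_eq.symm) hQ.ne_zero

end IsPeriodCofactor

end Chebyshev

section BranchPoints

variable {g : ℕ} {α β : Fin g → ℝ} {P : ℕ → ℝ[X]} {a b : ℕ → ℝ} {K : ℕ}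

namespace IsBranchPoints

lemma setOf_eval_nonpos (h : IsBranchPoints α β) :
    {x | (numer α * denom β).eval x ≤ 0} = E α β :=
  Set.ext fun _ => h.eval_nonpos_iff

lemma lt_one (h : IsBranchPoints α β) (j : Fin g) : α j < 1 := by
  rw [← bandRight_castSucc α]
  exact (h.bandRight_lt_bandLeft (Fin.castSucc_lt_last j)).trans
    ((h.band _).trans_le (h.bandRight_le_one _))

lemma not_isRoot_numer_one (h : IsBranchPoints α β) : ¬(numer α).IsRoot 1 := by
  rw [IsRoot.def, eval_numer]
  exact (Finset.prod_pos fun j _ => sub_pos.mpr (h.lt_one j)).ne'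

lemma rootMultiplicity_denom_one (h : IsBranchPoints α β) :
    (denom β).rootMultiplicity 1 = 1 := by
  have hroot : ¬(nodal univ (bandLeft β)).IsRoot 1 := by
    rw [IsRoot.def, Lagrange.eval_nodal, Finset.prod_eq_zero_iff]
    rintro ⟨k, -, hk⟩
    linarith [h.band k, h.bandRight_le_one k]
  rw [denom, rootMultiplicity_mul (monic_denom β).ne_zero, rootMultiplicity_X_sub_C_self,
    rootMultiplicity_eq_zero hroot]

lemma isCoprime_numer_denom (h : IsBranchPoints α β) : IsCoprime (numer α) (denom β) := by
  have hne {x y : ℝ} (hxy : x ≠ y) : IsCoprime (X - C x) (X - C y) :=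
    isCoprime_X_sub_C_of_isUnit_sub (sub_ne_zero.mpr hxy).isUnit
  have hband (i k : Fin (g + 1)) : bandRight α i ≠ bandLeft β k := by
    rcases lt_trichotomy i k with hik | rfl | hik
    · exact (h.bandRight_lt_bandLeft hik).ne
    · exact (h.band i).ne'
    · exact ((h.band k).trans ((h.bandRight_lt_bandLeft hik).trans (h.band i))).ne'
  rw [numer, denom, nodal, nodal]
  refine IsCoprime.prod_left fun j _ => (hne (h.lt_one j).ne).mul_right ?_
  exact IsCoprime.prod_right fun k _ => hne (bandRight_castSucc α j ▸ hband j.castSucc k)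

end IsBranchPoints

lemma aeval_numer_ne_zero (α : Fin g → ℝ) {z : ℂ} (hz : 0 < z.im) : aeval z (numer α) ≠ 0 := by
  rw [numer, nodal, map_prod]
  refine Finset.prod_ne_zero_iff.mpr fun j _ hj => hz.ne' ?_
  rw [map_sub, aeval_X, aeval_C, sub_eq_zero] at hj
  rw [hj, Complex.coe_algebraMap, Complex.ofReal_im]

lemma eval_numer_mul_denom_bandLeft (α β : Fin g → ℝ) (k : Fin (g + 1)) :
    (numer α * denom β).eval (bandLeft β k) = 0 := by
  rw [← nodal_mul_nodal, eval_mul, Lagrange.eval_nodal_at_node (Finset.mem_univ k), mul_zero]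

lemma eval_numer_mul_denom_bandRight (α β : Fin g → ℝ) (k : Fin (g + 1)) :
    (numer α * denom β).eval (bandRight α k) = 0 := by
  rw [← nodal_mul_nodal, eval_mul, Lagrange.eval_nodal_at_node (Finset.mem_univ k), zero_mul]

namespace IsMonicOrthogonal

lemma apply_zero (hP : IsMonicOrthogonal α β P) : P 0 = 1 :=
  (hP.monic 0).natDegree_eq_zero.mp (hP.natDegree_eq 0)

lemma coeff_pos (hP : IsMonicOrthogonal α β P) (h : IsBranchPoints α β)
    (hab : IsRecurrence P a b) (n : ℕ) : 0 < a (n + 1) :=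
  have := h.isFiniteMeasure
  (hP.isOrthogonalSequence h).coeff_pos hab (fun _ => h.moment_mul_self_pos) n

lemma Delta_pos (hP : IsMonicOrthogonal α β P) (h : IsBranchPoints α β) (n : ℕ) :
    0 < Delta α β P n := by
  have := h.isFiniteMeasure
  rw [Delta, Real.sqrt_pos, h.pairing_eq_moment]
  exact mul_pos two_pos (h.moment_mul_self_pos (hP.monic n).ne_zero)

lemma Delta_sq (hP : IsMonicOrthogonal α β P) (h : IsBranchPoints α β)
    (hab : IsRecurrence P a b) (n : ℕ) :
    Delta α β P n ^ 2 = 2 * ∏ i ∈ Finset.range n, a (i + 1) := by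
  have := h.isFiniteMeasure
  rw [Delta, Real.sq_sqrt (Real.sqrt_pos.mp (hP.Delta_pos h n)).le, h.pairing_eq_moment,
    (hP.isOrthogonalSequence h).map_self_eq_prod hab h.moment_one]

lemma exists_isPeriodCofactor (hP : IsMonicOrthogonal α β P) (h : IsBranchPoints α β)
    (hab : IsRecurrence P a b) (hK : HasPeriod a b K) :
    ∃ S, IsPeriodCofactor P a b K (numer α) (denom β) S := by
  have := h.isFiniteMeasure
  have hweyl := (hP.isOrthogonalSequence h).isWeylFunction h.ae_mem_Icc hab h.moment_one
  refine hweyl.exists_isPeriodCofactor hab hP.apply_zero (fun n => (hP.coeff_pos h hab n).ne') hK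
    ?_ h.not_isRoot_numer_one (h.rootMultiplicity_denom_one ▸ odd_one) h.isCoprime_numer_denom
  filter_upwards [eventually_gt_atTop 1] with z hz using h.sq_stieltjes_one_mul hz

lemma natDegree_normalized (hP : IsMonicOrthogonal α β P) (h : IsBranchPoints α β) (n : ℕ) :
    (normalized α β P n).natDegree = n := by
  rw [normalized, natDegree_C_mul (inv_ne_zero (hP.Delta_pos h n).ne'), hP.natDegree_eq]

end IsMonicOrthogonal

end BranchPoints

end GenChebyshev
end

open GenChebyshev in
theorem theorem4p1 {g : ℕ} (α β : Fin g → ℝ) (hE : GenChebyshev.IsBranchPoints α β)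
    (P : ℕ → Polynomial ℝ) (hP : GenChebyshev.IsMonicOrthogonal α β P)
    (a b : ℕ → ℝ) (hab : GenChebyshev.IsRecurrence P a b)
    (K : ℕ) (hK : GenChebyshev.HasPeriod a b K) :
    0 < GenChebyshev.Delta α β P K ∧
    (∀ k : Fin (g + 1),
      (fun x : ℝ => (GenChebyshev.normalized α β P K).eval x) '' GenChebyshev.band α β k =
        Set.Icc (-1) 1) ∧
    (fun x : ℝ => (GenChebyshev.normalized α β P K).eval x) ⁻¹' Set.Icc (-1) 1 =
      GenChebyshev.E α β ∧
    (fun z : ℂ => Polynomial.aeval z (GenChebyshev.normalized α β P K)) ⁻¹'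
        ((fun t : ℝ => (t : ℂ)) '' Set.Icc (-1) 1) =
      (fun x : ℝ => (x : ℂ)) '' GenChebyshev.E α β ∧
    (∀ n : ℕ, (GenChebyshev.monicT n).comp (GenChebyshev.normalized α β P K) =
      Polynomial.C (GenChebyshev.Delta α β P K ^ n)⁻¹ * P (n * K)) ∧
    g + 1 ≤ K := by
  obtain ⟨S, hS⟩ := hP.exists_isPeriodCofactor hE hab hK
  have hM : IsHerglotzPell (numer α) (denom β) (normalized α β P K) _ :=
    hS.isHerglotzPell hab hP.apply_zero (hP.coeff_pos hE hab) hK (hP.Delta_pos hE K).ne'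
      (hP.Delta_sq hE hab K)
  refine ⟨hP.Delta_pos hE K, fun k => ?_, Set.ext fun x => ?_, ?_, fun n => ?_, ?_⟩
  · refine hM.image_Icc_eq (hE.band k) (eval_numer_mul_denom_bandLeft α β k)
      (eval_numer_mul_denom_bandRight α β k) (fun x hx => ?_) ?_
    · exact hE.eval_nonpos_iff.mpr (Set.mem_iUnion_of_mem k hx)
    · exact (hP.natDegree_normalized hE K).trans_ne hK.pos.ne'
  · exact hM.mem_Icc_iff.trans hE.eval_nonpos_iff
  · rw [hM.preimage_aeval_eq fun _ => aeval_numer_ne_zero α, hE.setOf_eval_nonpos]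
  · exact hS.monicT_comp hab hP.apply_zero hK (hP.Delta_pos hE K).ne' (hP.Delta_sq hE hab K) n
  · exact natDegree_numer α ▸ hS.natDegree_lt hK.pos
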